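/- Let $\lambda>-1$ be real, let $w(x;t)=x^{\lambda}e^{-x^3/3+tx}$ for $x>0$, $t\in\mathbb R$, be the generalized Airy weight, and for $n=0,1,2,\dots$ put $$D_n(t)=\det\big(\mu_{i+j}(t)\big)_{i,j=0}^{n-1},\qquad \mu_j(t)=\int_0^\infty x^{j}w(x;t)\,dx ,$$ with $D_0(t)=1$. All these integrals converge absolutely and $D_n(t)>0$ for every real $t$. Let $G$ be the Barnes $G$-function, i.e. $$G(1+z)=(2\pi)^{z/2}e^{-\frac12(z+z^2(1+\gamma))}\prod_{k=1}^{\infty}\Big(1+\frac zk\Big)^{k}e^{\frac{z^2}{2k}-z},$$ where $\gamma$ is the Euler–Mascheroni constant. Then for all fixed $\lambda>-1$ and $n$: As $t\to+\infty$, $$\ln D_n(t)=\frac23\,n\,t^{3/2}-\frac{n(n-2\lambda)}{4}\ln t+\widetilde C_1(n)+\frac{n(4n^2-24n\lambda+12\lambda^2+1)}{48\,t^{3/2}}+O(t^{-3}),$$ where $$\widetilde C_1(n)=\frac n2\ln\pi-\frac{n(n-1)}2\ln2+\ln G(n+1).$$ As $t\to-\infty$, $$\ln D_n(t)=-n(n+\lambda)\ln(-t)+\widetilde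 C_2(n)+\frac{n(n+\lambda)(5n^2+5n\lambda+\lambda^2+1)}{3t^3}+O(t^{-6}),$$ where $$\widetilde C_2(n)=\ln\frac{G(n+1)\,G(n+\lambda+1)}{G(\lambda+1)}.$$ The constants implied by $O(\cdot)$ may depend on $n$ and $\lambda$. -/

import Mathlib

open Filter Asymptotics

namespace GeneralizedAiry

/-- The generalized Airy weight `w(x; t) = x ^ λ * exp (-x ^ 3 / 3 + t * x)`, used for `x > 0`. -/
noncomputable def weight (lam t x : ℝ) : ℝ :=
  x ^ lam * Real.exp (-(x ^ 3) / 3 + t * x)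

/-- The `j`-th moment `μ_j(t) = ∫_0^∞ x ^ j w(x; t) dx`. -/
noncomputable def moment (lam : ℝ) (j : ℕ) (t : ℝ) : ℝ :=
  ∫ x in Set.Ioi (0 : ℝ), x ^ j * weight lam t x

/-- The Hankel determinant `D_n(t) = det (μ_{i+j}(t))_{0 ≤ i, j ≤ n-1}` (so `D_0(t) = 1`). -/
noncomputable def hankelDet (lam : ℝ) (n : ℕ) (t : ℝ) : ℝ :=
  (Matrix.of fun i j : Fin n => moment lam ((i : ℕ) + (j : ℕ)) t).det

/-- The Barnes `G`-function on the real line, by its Weierstrass product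
`G(1 + w) = (2π)^(w/2) exp(-(w + w²(1 + γ))/2) ∏_{k ≥ 1} (1 + w/k)^k exp(w²/(2k) - w)`,
with `w = z - 1` and `γ` the Euler-Mascheroni constant. The product converges absolutely for every
real `w`; below, the factor with index `k : ℕ` is the one with `k + 1` in place of `k`. -/
noncomputable def barnesG (z : ℝ) : ℝ :=
  (2 * Real.pi) ^ ((z - 1) / 2) *
    Real.exp (-((z - 1) + (z - 1) ^ 2 * (1 + Real.eulerMascheroniConstant)) / 2) *
    ∏' k : ℕ, ((1 + (z - 1) / ((k : ℝ) + 1)) ^ (k + 1) *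
      Real.exp ((z - 1) ^ 2 / (2 * ((k : ℝ) + 1)) - (z - 1)))

end GeneralizedAiry

/-! Since `moment lam j` has derivative `moment lam (j + 1)`, the Hankel determinants satisfy the
Toda equation D_{m+2} D_m = D_{m+1} D_{m+1}'' - (D_{m+1}')², that is, log D_{m+2} = 2 log D_{m+1} -
log D_m + log((log D_{m+1})''). Both expansions therefore follow by two-step induction from n = 0,
which is trivial, and n = 1, the asymptotics of one integral. The algebraic coefficients are checked
to satisfy the recursion; the constants do so because G(z+1) = Γ(z) G(z), which is derived from the
Weierstrass product.

The induction differentiates asymptotic expansions, which a bare O-term does not permit. Remainders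
are therefore required to be symbols: each derivative gains a factor t⁻¹. This class is stable under
the operations needed (`IsSymbol.log_one_add`, `HasExpansion.second_deriv`), and Laplace integrals
belong to it (`LaplaceBound.isSymbol`), because differentiating in the large parameter multiplies
the amplitude by the phase, which lowers the order by one.

For n = 1 and t = -s, expanding e^{-x³/3} at 0 under the Laplace transform suffices. For t → +∞, the
scaling x = √t y gives the large parameter τ = t^{3/2} and a phase with minimum at y = 1. The
variable v = `airyRoot y` makes the phase equal to v², and a cubic Taylor polynomial of the
amplitude in v gives the two leading terms, with error O(τ^{-5/2}). -/

namespace GeneralizedAiry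

open MeasureTheory

/-! ### Symbols: remainders that may be differentiated -/

/-- `f` is, up to `N` derivatives, a symbol of order `m` at `+∞`: `f = O(t ^ m)`, and each
derivative gains a factor `t⁻¹`. -/
def IsSymbolUpTo : ℕ → ℝ → (ℝ → ℝ) → Prop
  | 0, m, f => f =O[atTop] fun t : ℝ => t ^ m
  | N + 1, m, f => (f =O[atTop] fun t : ℝ => t ^ m) ∧
      ∃ f' : ℝ → ℝ, (∀ᶠ t in atTop, HasDerivAt f (f' t) t) ∧ IsSymbolUpTo N (m - 1) f'

/-- Symbols of order `m` at `+∞`. -/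
def IsSymbol (m : ℝ) (f : ℝ → ℝ) : Prop := ∀ N, IsSymbolUpTo N m f

theorem IsSymbolUpTo.isBigO {N : ℕ} {m : ℝ} {f : ℝ → ℝ} (h : IsSymbolUpTo N m f) :
    f =O[atTop] fun t : ℝ => t ^ m := by
  cases N with
  | zero => exact h
  | succ N => exact h.1

theorem IsSymbolUpTo.of_succ {N : ℕ} {m : ℝ} {f : ℝ → ℝ} (h : IsSymbolUpTo (N + 1) m f) :
    IsSymbolUpTo N m f := by
  induction N generalizing m f with
  | zero => exact h.1
  | succ N ih =>
    obtain ⟨h0, f', h1, h2⟩ := h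
    exact ⟨h0, f', h1, ih h2⟩

theorem isBigO_rpow_rpow {m m' : ℝ} (h : m ≤ m') :
    (fun t : ℝ => t ^ m) =O[atTop] fun t : ℝ => t ^ m' := by
  refine IsBigO.of_bound 1 ?_
  filter_upwards [eventually_ge_atTop 1] with t ht
  have h0 : (0 : ℝ) ≤ t := by linarith
  rw [Real.norm_of_nonneg (Real.rpow_nonneg h0 _), Real.norm_of_nonneg (Real.rpow_nonneg h0 _),
    one_mul]
  exact Real.rpow_le_rpow_of_exponent_le ht h

theorem IsSymbolUpTo.mono {N : ℕ} {m m' : ℝ} {f : ℝ → ℝ} (h : IsSymbolUpTo N m f)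
    (hm : m ≤ m') : IsSymbolUpTo N m' f := by
  induction N generalizing m m' f with
  | zero => exact IsBigO.trans h (isBigO_rpow_rpow hm)
  | succ N ih =>
    obtain ⟨h0, f', h1, h2⟩ := h
    exact ⟨h0.trans (isBigO_rpow_rpow hm), f', h1, ih h2 (by linarith)⟩

/-- Equality for all large t holds near each large t, so the derivatives of the two sides may be
compared as well. -/
theorem eventually_eventuallyEq_nhds {f g : ℝ → ℝ} (h : f =ᶠ[atTop] g) :
    ∀ᶠ t in atTop, f =ᶠ[nhds t] g := by
  obtain ⟨a, ha⟩ := eventually_atTop.1 h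
  filter_upwards [eventually_gt_atTop a] with t ht
  filter_upwards [lt_mem_nhds ht] with x hx using ha x hx.le

theorem IsSymbolUpTo.congr {N : ℕ} {m : ℝ} {f g : ℝ → ℝ} (h : IsSymbolUpTo N m f)
    (hfg : f =ᶠ[atTop] g) : IsSymbolUpTo N m g := by
  cases N with
  | zero => exact IsBigO.congr' h hfg EventuallyEq.rfl
  | succ N =>
    obtain ⟨h0, f', h1, h2⟩ := h
    refine ⟨h0.congr' hfg EventuallyEq.rfl, f', ?_, h2⟩
    filter_upwards [h1, eventually_eventuallyEq_nhds hfg] with t ht he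
    exact ht.congr_of_eventuallyEq he.symm

theorem IsSymbolUpTo.zero (N : ℕ) (m : ℝ) : IsSymbolUpTo N m fun _ => 0 := by
  induction N generalizing m with
  | zero => exact isBigO_zero _ _
  | succ N ih => exact ⟨isBigO_zero _ _, fun _ => 0, .of_forall fun t => hasDerivAt_const t 0, ih _⟩

theorem IsSymbolUpTo.add {N : ℕ} {m : ℝ} {f g : ℝ → ℝ} (hf : IsSymbolUpTo N m f)
    (hg : IsSymbolUpTo N m g) : IsSymbolUpTo N m fun t => f t + g t := by
  induction N generalizing m f g with
  | zero => exact IsBigO.add hf hg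
  | succ N ih =>
    obtain ⟨h0, f', h1, h2⟩ := hf
    obtain ⟨k0, g', k1, k2⟩ := hg
    refine ⟨h0.add k0, fun t => f' t + g' t, ?_, ih h2 k2⟩
    filter_upwards [h1, k1] with t a b using a.add b

theorem isBigO_mul_rpow {m m' : ℝ} {f g : ℝ → ℝ} (hf : f =O[atTop] fun t : ℝ => t ^ m)
    (hg : g =O[atTop] fun t : ℝ => t ^ m') :
    (fun t => f t * g t) =O[atTop] fun t : ℝ => t ^ (m + m') := by
  refine (hf.mul hg).congr' EventuallyEq.rfl ?_
  filter_upwards [eventually_gt_atTop 0] with t ht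
  rw [Real.rpow_add ht]

theorem IsSymbolUpTo.mul {N : ℕ} {m m' : ℝ} {f g : ℝ → ℝ} (hf : IsSymbolUpTo N m f)
    (hg : IsSymbolUpTo N m' g) : IsSymbolUpTo N (m + m') fun t => f t * g t := by
  induction N generalizing m m' f g with
  | zero => exact isBigO_mul_rpow hf hg
  | succ N ih =>
    have hf0 := hf.of_succ
    have hg0 := hg.of_succ
    obtain ⟨h0, f', h1, h2⟩ := hf
    obtain ⟨k0, g', k1, k2⟩ := hg
    refine ⟨isBigO_mul_rpow h0 k0, fun t => f' t * g t + f t * g' t, ?_, ?_⟩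
    · filter_upwards [h1, k1] with t a b using a.mul b
    · exact ((ih h2 hg0).mono (by linarith)).add ((ih hf0 k2).mono (by linarith))

theorem IsSymbolUpTo.const (N : ℕ) (c : ℝ) : IsSymbolUpTo N 0 fun _ => c := by
  have h : (fun _ : ℝ => c) =O[atTop] fun t : ℝ => t ^ (0 : ℝ) := by
    simp only [Real.rpow_zero]
    exact isBigO_const_const c one_ne_zero _
  cases N with
  | zero => exact h
  | succ N => exact ⟨h, fun _ => 0, .of_forall fun t => hasDerivAt_const t c, .zero N _⟩

theorem IsSymbolUpTo.const_mul {N : ℕ} {m : ℝ} {f : ℝ → ℝ} (hf : IsSymbolUpTo N m f) (c : ℝ) :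
    IsSymbolUpTo N m fun t => c * f t := by
  simpa using (IsSymbolUpTo.const N c).mul hf

theorem IsSymbolUpTo.rpow (N : ℕ) (a : ℝ) : IsSymbolUpTo N a fun t => t ^ a := by
  induction N generalizing a with
  | zero => exact isBigO_refl _ _
  | succ N ih =>
    refine ⟨isBigO_refl _ _, fun t => a * t ^ (a - 1), ?_, (ih (a - 1)).const_mul a⟩
    filter_upwards [eventually_gt_atTop 0] with t ht
    exact Real.hasDerivAt_rpow_const (Or.inl ht.ne')

theorem IsSymbolUpTo.comp_rpow {N : ℕ} {m p : ℝ} {f : ℝ → ℝ} (hf : IsSymbolUpTo N m f)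
    (hp : 0 < p) : IsSymbolUpTo N (p * m) fun t => f (t ^ p) := by
  have key : ∀ {m : ℝ} {f : ℝ → ℝ}, (f =O[atTop] fun t : ℝ => t ^ m) →
      (fun t => f (t ^ p)) =O[atTop] fun t : ℝ => t ^ (p * m) := by
    intro m f h
    refine (h.comp_tendsto (tendsto_rpow_atTop hp)).congr' EventuallyEq.rfl ?_
    filter_upwards [eventually_gt_atTop 0] with t ht
    simp [Real.rpow_mul ht.le]
  induction N generalizing m f with
  | zero => exact key hf
  | succ N ih =>
    obtain ⟨h0, f', h1, h2⟩ := hf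
    refine ⟨key h0, fun t => f' (t ^ p) * (p * t ^ (p - 1)), ?_, ?_⟩
    · filter_upwards [(tendsto_rpow_atTop hp).eventually h1, eventually_gt_atTop 0] with t a ht
      exact a.comp t (Real.hasDerivAt_rpow_const (Or.inl ht.ne'))
    · exact ((ih h2).mul ((IsSymbolUpTo.rpow N (p - 1)).const_mul p)).mono (by linarith)

theorem tendsto_zero_of_isBigO_rpow {m : ℝ} {f : ℝ → ℝ} (hf : f =O[atTop] fun t : ℝ => t ^ m)
    (hm : m < 0) : Tendsto f atTop (nhds 0) := by
  refine hf.trans_tendsto ?_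
  simpa using tendsto_rpow_neg_atTop (y := -m) (by linarith)

theorem eventually_one_add_pos {m : ℝ} {f : ℝ → ℝ} (hf : f =O[atTop] fun t : ℝ => t ^ m)
    (hm : m < 0) : ∀ᶠ t in atTop, 1 / 2 < 1 + f t := by
  filter_upwards [(tendsto_zero_of_isBigO_rpow hf hm).eventually_const_lt
    (show (-1 / 2 : ℝ) < 0 by norm_num)] with t ht
  linarith

theorem IsSymbolUpTo.inv_one_add {N : ℕ} {m : ℝ} {f : ℝ → ℝ} (hf : IsSymbolUpTo N m f)
    (hm : m < 0) : IsSymbolUpTo N 0 fun t => (1 + f t)⁻¹ := by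
  have key : (fun t => (1 + f t)⁻¹) =O[atTop] fun t : ℝ => t ^ (0 : ℝ) := by
    refine IsBigO.of_bound 2 ?_
    filter_upwards [eventually_one_add_pos hf.isBigO hm] with t ht
    rw [Real.norm_of_nonneg (by positivity), Real.rpow_zero, norm_one,
      inv_le_comm₀ (by linarith) (by norm_num)]
    linarith
  induction N with
  | zero => exact key
  | succ N ih =>
    have hi := ih hf.of_succ
    have hpos := eventually_one_add_pos hf.isBigO hm
    obtain ⟨h0, f', h1, h2⟩ := hf
    refine ⟨key, fun t => (-1) * (f' t * ((1 + f t)⁻¹ * (1 + f t)⁻¹)), ?_, ?_⟩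
    · filter_upwards [h1, hpos] with t a ht
      refine ((a.const_add 1).inv (by linarith)).congr_deriv ?_
      have : 1 + f t ≠ 0 := by linarith
      field_simp
    · exact ((h2.mul (hi.mul hi)).const_mul (-1)).mono (by linarith)

/-- The function itself is quadratic in f, and its derivative is -f f' / (1 + f), a product of
symbols of total order 2m - 1. -/
theorem IsSymbolUpTo.log_one_add_sub {N : ℕ} {m : ℝ} {f : ℝ → ℝ} (hf : IsSymbolUpTo N m f)
    (hm : m < 0) : IsSymbolUpTo N (m + m) fun t => Real.log (1 + f t) - f t := by
  have hpos := eventually_one_add_pos hf.isBigO hm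
  have key : (fun t => Real.log (1 + f t) - f t) =O[atTop] fun t : ℝ => t ^ (m + m) := by
    refine IsBigO.trans (g := fun t => f t * f t) ?_ (isBigO_mul_rpow hf.isBigO hf.isBigO)
    refine IsBigO.of_bound 2 ?_
    filter_upwards [hpos] with t ht
    have h1 := Real.log_le_sub_one_of_pos (show 0 < 1 + f t by linarith)
    have h2 := Real.one_sub_inv_le_log_of_pos (show 0 < 1 + f t by linarith)
    have h3 : 1 - (1 + f t)⁻¹ = f t - f t * f t * (1 + f t)⁻¹ := by
      have : 1 + f t ≠ 0 := by linarith
      field_simp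
      ring
    have h4 : (1 + f t)⁻¹ ≤ 2 := by
      rw [inv_le_comm₀ (by linarith) (by norm_num)]
      linarith
    have h5 : f t * f t * (1 + f t)⁻¹ ≤ f t * f t * 2 :=
      mul_le_mul_of_nonneg_left h4 (mul_self_nonneg _)
    rw [Real.norm_eq_abs, Real.norm_of_nonneg (mul_self_nonneg _), abs_le]
    constructor <;> linarith [mul_self_nonneg (f t)]
  cases N with
  | zero => exact key
  | succ N =>
    have hf0 := hf.of_succ
    obtain ⟨h0, f', h1, h2⟩ := hf
    refine ⟨key, fun t => (-1) * (f t * (f' t * (1 + f t)⁻¹)), ?_, ?_⟩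
    · filter_upwards [h1, hpos] with t a ht
      refine (((a.const_add 1).log (by linarith)).sub a).congr_deriv ?_
      have : 1 + f t ≠ 0 := by linarith
      field_simp
      ring
    · exact ((hf0.mul (h2.mul (hf0.inv_one_add hm))).const_mul (-1)).mono (by linarith)

theorem IsSymbol.isBigO {m : ℝ} {f : ℝ → ℝ} (h : IsSymbol m f) :
    f =O[atTop] fun t : ℝ => t ^ m := h 0

theorem IsSymbol.mono {m m' : ℝ} {f : ℝ → ℝ} (h : IsSymbol m f) (hm : m ≤ m') : IsSymbol m' f :=
  fun N => (h N).mono hm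

theorem IsSymbol.add {m : ℝ} {f g : ℝ → ℝ} (hf : IsSymbol m f) (hg : IsSymbol m g) :
    IsSymbol m fun t => f t + g t := fun N => (hf N).add (hg N)

theorem IsSymbol.mul {m m' : ℝ} {f g : ℝ → ℝ} (hf : IsSymbol m f) (hg : IsSymbol m' g) :
    IsSymbol (m + m') fun t => f t * g t := fun N => (hf N).mul (hg N)

theorem IsSymbol.const_mul {m : ℝ} {f : ℝ → ℝ} (hf : IsSymbol m f) (c : ℝ) :
    IsSymbol m fun t => c * f t := fun N => (hf N).const_mul c

theorem IsSymbol.zero (m : ℝ) : IsSymbol m fun _ => 0 := fun N => .zero N m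

theorem IsSymbol.rpow (a : ℝ) : IsSymbol a fun t => t ^ a := fun N => .rpow N a

theorem IsSymbol.comp_rpow {m p : ℝ} {f : ℝ → ℝ} (hf : IsSymbol m f) (hp : 0 < p) :
    IsSymbol (p * m) fun t => f (t ^ p) := fun N => (hf N).comp_rpow hp

/-- The logarithm of `1 + c t ^ (-q) + O(t ^ (-2q))`, for symbols. -/
theorem IsSymbol.log_one_add {q c : ℝ} {f : ℝ → ℝ} (hf : IsSymbol (-(2 * q)) f) (hq : 0 < q) :
    IsSymbol (-(2 * q)) fun t => Real.log (1 + (c * t ^ (-q) + f t)) - c * t ^ (-q) := by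
  intro N
  have h1 : IsSymbolUpTo N (-q) fun t => c * t ^ (-q) + f t :=
    ((IsSymbolUpTo.rpow N (-q)).const_mul c).add ((hf N).mono (by linarith))
  refine (((h1.log_one_add_sub (by linarith)).mono (by linarith)).add (hf N)).congr
    (.of_forall fun t => ?_)
  ring

theorem IsSymbol.eventually_pos {q c : ℝ} {f : ℝ → ℝ} (hf : IsSymbol (-(2 * q)) f) (hq : 0 < q) :
    ∀ᶠ t in atTop, 0 < 1 + (c * t ^ (-q) + f t) := by
  have h1 : IsSymbol (-q) fun t => c * t ^ (-q) + f t :=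
    ((IsSymbol.rpow (-q)).const_mul c).add (hf.mono (by linarith))
  filter_upwards [eventually_one_add_pos h1.isBigO (by linarith)] with t ht
  linarith

/-- The derivative supplied by the definition depends on N; uniqueness of derivatives makes one
choice serve for every N. -/
theorem IsSymbol.exists_hasDerivAt {m : ℝ} {f : ℝ → ℝ} (hf : IsSymbol m f) :
    ∃ f' : ℝ → ℝ, (∀ᶠ t in atTop, HasDerivAt f (f' t) t) ∧ IsSymbol (m - 1) f' := by
  obtain ⟨-, f', h1, -⟩ := hf 1
  refine ⟨f', h1, fun N => ?_⟩
  obtain ⟨-, g', k1, k2⟩ := hf (N + 1)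
  refine k2.congr ?_
  filter_upwards [h1, k1] with t a b using b.unique a

/-! ### Laplace integrals are symbols -/

section Laplace
variable {α : Type*} [MeasurableSpace α] {μ : Measure α} {φ g : α → ℝ}

/-- The Laplace-type integral with phase `φ` and amplitude `g` converges absolutely and is
`O(τ ^ m)` in absolute value. -/
def LaplaceBound (μ : Measure α) (φ g : α → ℝ) (m : ℝ) : Prop :=
  AEStronglyMeasurable g μ ∧ ∃ C : ℝ, ∀ᶠ τ in atTop,
    Integrable (fun x => g x * Real.exp (-(τ * φ x))) μ ∧
      ∫ x, |g x| * Real.exp (-(τ * φ x)) ∂μ ≤ C * τ ^ m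

/-- Half of the exponential absorbs the factor y at the price of 2 / τ. -/
theorem mul_exp_neg_mul_le {τ y : ℝ} (hτ : 0 < τ) :
    y * Real.exp (-(τ * y)) ≤ 2 / τ * Real.exp (-(τ / 2 * y)) := by
  have h1 : τ / 2 * y ≤ Real.exp (τ / 2 * y) := by
    linarith [Real.add_one_le_exp (τ / 2 * y)]
  have h2 : Real.exp (-(τ * y)) = Real.exp (-(τ / 2 * y)) * Real.exp (-(τ / 2 * y)) := by
    rw [← Real.exp_add]
    ring_nf
  have h3 : τ / 2 * y * Real.exp (-(τ / 2 * y)) ≤ 1 := by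
    rw [Real.exp_neg, ← div_eq_mul_inv]
    exact div_le_one_of_le₀ h1 (Real.exp_nonneg _)
  rw [h2]
  calc y * (Real.exp (-(τ / 2 * y)) * Real.exp (-(τ / 2 * y)))
      = 2 / τ * (τ / 2 * y * Real.exp (-(τ / 2 * y))) * Real.exp (-(τ / 2 * y)) := by
        field_simp
    _ ≤ 2 / τ * 1 * Real.exp (-(τ / 2 * y)) := by gcongr
    _ = _ := by ring

theorem LaplaceBound.isBigO {m : ℝ} (h : LaplaceBound μ φ g m) :
    (fun τ => ∫ x, g x * Real.exp (-(τ * φ x)) ∂μ) =O[atTop] fun τ : ℝ => τ ^ m := by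
  obtain ⟨-, C, h⟩ := h
  refine IsBigO.of_bound C ?_
  filter_upwards [h, eventually_gt_atTop 0] with τ hτ h0
  rw [Real.norm_of_nonneg (Real.rpow_nonneg h0.le m)]
  refine (norm_integral_le_integral_norm _).trans (le_trans (le_of_eq ?_) hτ.2)
  simp

/-- A factor φ costs half of the exponential and gains 2 / τ; the bound is then applied at τ / 2,
which changes only the constant. -/
theorem LaplaceBound.mul_phase {m : ℝ} (h : LaplaceBound μ φ g m) (hφ : AEStronglyMeasurable φ μ)
    (hpos : ∀ᵐ x ∂μ, 0 ≤ φ x) : LaplaceBound μ φ (fun x => g x * φ x) (m - 1) := by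
  obtain ⟨hg, C, h⟩ := h
  refine ⟨hg.mul hφ, 2 * (1 / 2) ^ m * C, ?_⟩
  filter_upwards [(tendsto_id.atTop_mul_const (show (0 : ℝ) < 1 / 2 by norm_num)).eventually h,
    eventually_gt_atTop 0] with τ hτ h0
  simp only [id] at hτ
  have hexp : AEStronglyMeasurable (fun x => Real.exp (-(τ * φ x))) μ :=
    Real.continuous_exp.comp_aestronglyMeasurable (hφ.const_mul τ).neg
  have hle : ∀ᵐ x ∂μ, |g x * φ x| * Real.exp (-(τ * φ x))
      ≤ 2 / τ * (|g x| * Real.exp (-(τ * (1 / 2) * φ x))) := by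
    filter_upwards [hpos] with x hx
    have := mul_exp_neg_mul_le (y := φ x) h0
    rw [abs_mul, abs_of_nonneg hx, mul_assoc, mul_left_comm (2 / τ),
      show τ * (1 / 2) * φ x = τ / 2 * φ x by ring]
    exact mul_le_mul_of_nonneg_left this (abs_nonneg _)
  have hint : Integrable (fun x => 2 / τ * (|g x| * Real.exp (-(τ * (1 / 2) * φ x)))) μ := by
    refine Integrable.const_mul ?_ _
    simpa [abs_mul] using hτ.1.abs
  have hint' : Integrable (fun x => g x * φ x * Real.exp (-(τ * φ x))) μ := by
    refine hint.mono' ((hg.mul hφ).mul hexp) ?_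
    filter_upwards [hle] with x hx
    simpa [abs_mul] using hx
  refine ⟨hint', ?_⟩
  calc ∫ x, |g x * φ x| * Real.exp (-(τ * φ x)) ∂μ
      ≤ ∫ x, 2 / τ * (|g x| * Real.exp (-(τ * (1 / 2) * φ x))) ∂μ := by
        refine integral_mono_ae ?_ hint hle
        simpa [abs_mul] using hint'.abs
    _ = 2 / τ * ∫ x, |g x| * Real.exp (-(τ * (1 / 2) * φ x)) ∂μ := integral_const_mul _ _
    _ ≤ 2 / τ * (C * (τ * (1 / 2)) ^ m) := by gcongr; exact hτ.2
    _ = 2 * (1 / 2) ^ m * C * τ ^ (m - 1) := by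
        rw [Real.mul_rpow h0.le (by norm_num), Real.rpow_sub_one h0.ne']
        ring

theorem LaplaceBound.hasDerivAt {m : ℝ} (h : LaplaceBound μ φ g m)
    (hφ : AEStronglyMeasurable φ μ) (hpos : ∀ᵐ x ∂μ, 0 ≤ φ x) :
    ∀ᶠ τ in atTop, HasDerivAt (fun τ => ∫ x, g x * Real.exp (-(τ * φ x)) ∂μ)
      (-∫ x, g x * φ x * Real.exp (-(τ * φ x)) ∂μ) τ := by
  obtain ⟨hg, C, h⟩ := h
  obtain ⟨T, hT⟩ := eventually_atTop.1 h
  filter_upwards [eventually_ge_atTop (T + 2)] with τ hτ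
  have hexp : ∀ s : ℝ, AEStronglyMeasurable (fun x => Real.exp (-(s * φ x))) μ := fun s =>
    Real.continuous_exp.comp_aestronglyMeasurable (hφ.const_mul s).neg
  have key := hasDerivAt_integral_of_dominated_loc_of_deriv_le (μ := μ) (𝕜 := ℝ)
    (F := fun τ x => g x * Real.exp (-(τ * φ x)))
    (F' := fun τ x => -(g x * φ x * Real.exp (-(τ * φ x)))) (x₀ := τ)
    (bound := fun x => |g x * Real.exp (-((τ - 2) * φ x))|) (Metric.ball_mem_nhds τ one_pos)
    (.of_forall fun s => hg.mul (hexp s)) (hT τ (by linarith)).1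
    (((hg.mul hφ).mul (hexp τ)).neg) ?_ (hT (τ - 2) (by linarith)).1.abs ?_
  · simpa [integral_neg] using key.2
  · filter_upwards [hpos] with x hx s hs
    have hs' : τ - 1 < s := by
      have := abs_lt.1 (by simpa [Real.dist_eq] using hs : |s - τ| < 1)
      linarith
    rw [norm_neg, Real.norm_eq_abs, abs_mul, abs_mul, abs_mul, abs_of_nonneg hx, mul_assoc,
      Real.abs_exp, Real.abs_exp]
    refine mul_le_mul_of_nonneg_left ?_ (abs_nonneg _)
    -- One unit of the parameter is lost on the ball of radius 1 and one on φ ≤ e^φ, so the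
    -- integrand at τ - 2 dominates.
    calc φ x * Real.exp (-(s * φ x)) ≤ Real.exp (φ x) * Real.exp (-((τ - 1) * φ x)) := by
          gcongr
          linarith [Real.add_one_le_exp (φ x)]
      _ = _ := by
          rw [← Real.exp_add]
          ring_nf
  · refine .of_forall fun x s _ => ?_
    have h1 : HasDerivAt (fun s : ℝ => -(s * φ x)) (-(φ x)) s :=
      ((hasDerivAt_id s).mul_const (φ x)).neg.congr_deriv (by simp)
    exact (h1.exp.const_mul (g x)).congr_deriv (by ring)

/-- Laplace-type integrals are symbols. -/
theorem LaplaceBound.isSymbol {m : ℝ} (h : LaplaceBound μ φ g m)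
    (hφ : AEStronglyMeasurable φ μ) (hpos : ∀ᵐ x ∂μ, 0 ≤ φ x) :
    IsSymbol m fun τ => ∫ x, g x * Real.exp (-(τ * φ x)) ∂μ := by
  intro N
  induction N generalizing g m with
  | zero => exact h.isBigO
  | succ N ih =>
    refine ⟨h.isBigO, _, h.hasDerivAt hφ hpos, ?_⟩
    simpa using (ih (h.mul_phase hφ hpos)).const_mul (-1)

end Laplace

/-! ### Moments and positivity of the Hankel determinants -/

section Moments

theorem integrableOn_rpow_mul_exp_cubic {a : ℝ} (ha : -1 < a) (t : ℝ) :
    IntegrableOn (fun x : ℝ => x ^ a * Real.exp (-(x ^ 3) / 3 + t * x)) (Set.Ioi 0) := by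
  have h := Real.GammaIntegral_convergent (s := a + 1) (by linarith)
  simp only [add_sub_cancel_right] at h
  set b : ℝ := |t| + 1
  have hb : 1 ≤ b := by simp [b]
  refine (h.const_mul (Real.exp (b * (3 * b + 1)))).mono' ?_ ?_
  · refine ContinuousOn.aestronglyMeasurable (fun x hx => ?_) measurableSet_Ioi
    refine ContinuousAt.continuousWithinAt ?_
    exact (Real.continuousAt_rpow_const x a (Or.inl (ne_of_gt hx))).mul (by fun_prop)
  · refine (ae_restrict_mem measurableSet_Ioi).mono fun x hx => ?_
    have hx : 0 < x := hx
    rw [Real.norm_of_nonneg (by positivity), mul_comm (x ^ a), ← mul_assoc, ← Real.exp_add]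
    refine mul_le_mul_of_nonneg_right (Real.exp_le_exp.2 ?_) (Real.rpow_nonneg hx.le a)
    have h1 : (t + 1) * x ≤ b * x :=
      mul_le_mul_of_nonneg_right (by simp [b, le_abs_self]) hx.le
    -- This yields e^{-x³/3 + tx} ≤ const · e^{-x}, a Gamma integrand. Beyond x = 3b + 1 the cubic
    -- term already beats b x, since x² ≥ 3b.
    suffices b * x - x ^ 3 / 3 ≤ b * (3 * b + 1) by nlinarith
    rcases le_total x (3 * b + 1) with h | h
    · have : b * x ≤ b * (3 * b + 1) := by gcongr
      have : 0 ≤ x ^ 3 := by positivity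
      linarith
    · have h2 : 3 * b ≤ x ^ 2 := by nlinarith
      have h3 : 3 * b * x ≤ x ^ 2 * x := by gcongr
      have h4 : 0 ≤ b * (3 * b + 1) := by positivity
      nlinarith

theorem pow_mul_weight {x : ℝ} (hx : 0 < x) (lam : ℝ) (j : ℕ) (t : ℝ) :
    x ^ j * weight lam t x = x ^ (lam + j) * Real.exp (-(x ^ 3) / 3 + t * x) := by
  rw [weight, Real.rpow_add hx, Real.rpow_natCast]
  ring

theorem integrableOn_pow_mul_weight {lam : ℝ} (hlam : -1 < lam) (j : ℕ) (t : ℝ) :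
    IntegrableOn (fun x : ℝ => x ^ j * weight lam t x) (Set.Ioi 0) := by
  have h := integrableOn_rpow_mul_exp_cubic (a := lam + j)
    (by linarith [Nat.cast_nonneg (α := ℝ) j]) t
  exact h.congr_fun (fun x hx => (pow_mul_weight hx lam j t).symm) measurableSet_Ioi

theorem hasDerivAt_moment {lam : ℝ} (hlam : -1 < lam) (j : ℕ) (t : ℝ) :
    HasDerivAt (moment lam j) (moment lam (j + 1) t) t := by
  have key := hasDerivAt_integral_of_dominated_loc_of_deriv_le (𝕜 := ℝ)
    (μ := volume.restrict (Set.Ioi (0 : ℝ)))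
    (F := fun s x => x ^ j * weight lam s x) (F' := fun s x => x ^ (j + 1) * weight lam s x)
    (x₀ := t) (bound := fun x => x ^ (j + 1) * weight lam (t + 1) x)
    (Metric.ball_mem_nhds t one_pos)
    (.of_forall fun s => (integrableOn_pow_mul_weight hlam j s).aestronglyMeasurable)
    (integrableOn_pow_mul_weight hlam j t)
    (integrableOn_pow_mul_weight hlam (j + 1) t).aestronglyMeasurable ?_
    (integrableOn_pow_mul_weight hlam (j + 1) (t + 1)) ?_
  · exact key.2
  · refine (ae_restrict_mem measurableSet_Ioi).mono fun x hx s hs => ?_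
    have hx : 0 < x := hx
    have hs' : s ≤ t + 1 := by
      have := abs_lt.1 (by simpa [Real.dist_eq] using hs : |s - t| < 1)
      linarith
    have : 0 ≤ weight lam s x := by unfold weight; positivity
    rw [Real.norm_of_nonneg (by positivity)]
    unfold weight
    gcongr
  · refine .of_forall fun x s _ => ?_
    have h1 : HasDerivAt (fun s : ℝ => -(x ^ 3) / 3 + s * x) x s :=
      (((hasDerivAt_id s).mul_const x).const_add _).congr_deriv (by simp)
    refine ((h1.exp.const_mul (x ^ lam)).const_mul (x ^ j)).congr_deriv ?_
    rw [weight, pow_succ]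
    ring

/-- The matrix is a Gram matrix: its quadratic form at c is the integral of p² times the weight, p
being the polynomial with coefficients c, and a nonzero p vanishes only on a finite set. -/
theorem hankelDet_pos {lam : ℝ} (hlam : -1 < lam) (n : ℕ) (t : ℝ) : 0 < hankelDet lam n t := by
  refine Matrix.PosDef.det_pos (Matrix.PosDef.of_dotProduct_mulVec_pos ?_ fun c hc => ?_)
  · ext i j
    simp [add_comm]
  · have hint : ∀ i j : Fin n, IntegrableOn (fun x : ℝ => c i * (c j *
        (x ^ ((i : ℕ) + (j : ℕ)) * weight lam t x))) (Set.Ioi 0) := fun i j =>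
      ((integrableOn_pow_mul_weight hlam _ t).const_mul _).const_mul _
    have hsum : ∀ x : ℝ, ∑ i : Fin n, ∑ j : Fin n,
        c i * (c j * (x ^ ((i : ℕ) + (j : ℕ)) * weight lam t x))
        = (∑ i : Fin n, c i * x ^ (i : ℕ)) ^ 2 * weight lam t x := by
      intro x
      rw [sq, Finset.sum_mul_sum, Finset.sum_mul]
      refine Finset.sum_congr rfl fun i _ => ?_
      rw [Finset.sum_mul]
      refine Finset.sum_congr rfl fun j _ => ?_
      rw [pow_add]
      ring
    have heq : star c ⬝ᵥ (Matrix.of fun i j : Fin n => moment lam ((i : ℕ) + (j : ℕ)) t).mulVec c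
        = ∫ x in Set.Ioi (0 : ℝ), (∑ i : Fin n, c i * x ^ (i : ℕ)) ^ 2 * weight lam t x := by
      simp_rw [← hsum]
      rw [integral_finsetSum _ fun i _ => integrable_finsetSum _ fun j _ => hint i j]
      simp only [dotProduct, Matrix.mulVec, Matrix.of_apply, star_trivial, Finset.mul_sum]
      refine Finset.sum_congr rfl fun i _ => ?_
      rw [integral_finsetSum _ fun j _ => hint i j]
      refine Finset.sum_congr rfl fun j _ => ?_
      rw [integral_const_mul, integral_const_mul, moment]
      ring
    have hw : ∀ x ∈ Set.Ioi (0 : ℝ), 0 < weight lam t x := fun x hx => by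
      have hx : 0 < x := hx
      unfold weight
      positivity
    rw [heq, setIntegral_pos_iff_support_of_nonneg_ae]
    · set p : Polynomial ℝ := ∑ i : Fin n, Polynomial.monomial (i : ℕ) (c i)
      have hp : p ≠ 0 := by
        obtain ⟨i, hi⟩ := Function.ne_iff.1 hc
        intro h
        apply hi
        have := congrArg (fun q => Polynomial.coeff q (i : ℕ)) h
        simpa [p, Polynomial.finsetSum_coeff, Polynomial.coeff_monomial, Fin.val_inj] using this
      have heval : ∀ x, p.eval x = ∑ i : Fin n, c i * x ^ (i : ℕ) := fun x => by
        simp [p, Polynomial.eval_finsetSum]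
      have hsub : Set.Ioi (0 : ℝ) \ (p.roots.toFinset : Set ℝ) ⊆
          (Function.support fun x : ℝ => (∑ i : Fin n, c i * x ^ (i : ℕ)) ^ 2 * weight lam t x) ∩
            Set.Ioi 0 := by
        rintro x ⟨hx, hxr⟩
        refine ⟨?_, hx⟩
        have : p.eval x ≠ 0 := by simpa [hp] using hxr
        rw [heval] at this
        exact mul_ne_zero (pow_ne_zero 2 this) (hw x hx).ne'
      refine lt_of_lt_of_le ?_ (measure_mono hsub)
      rw [measure_sdiff_null ((Finset.finite_toSet _).measure_zero _)]
      simp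
    · exact (ae_restrict_mem measurableSet_Ioi).mono fun x hx => by
        have := (hw x hx).le
        simp only [Pi.zero_apply]
        positivity
    · simp_rw [← hsum]
      exact integrable_finsetSum _ fun i _ => integrable_finsetSum _ fun j _ => hint i j

end Moments

/-! ### The Toda equation -/

section Toda

theorem hasDerivAt_det {ι : Type*} [Fintype ι] [DecidableEq ι] {A : ℝ → Matrix ι ι ℝ}
    {A' : Matrix ι ι ℝ} {t : ℝ} (h : ∀ i j, HasDerivAt (fun s => A s i j) (A' i j) t) :
    HasDerivAt (fun s => (A s).det) (∑ j, ((A t).updateCol j fun i => A' i j).det) t := by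
  simp_rw [Matrix.det_apply']
  rw [Finset.sum_comm]
  refine HasDerivAt.fun_sum fun σ _ => ?_
  rw [← Finset.mul_sum]
  refine HasDerivAt.const_mul _ ?_
  refine (HasDerivAt.fun_finsetProd fun i _ => h (σ i) i).congr_deriv ?_
  refine Finset.sum_congr rfl fun j hj => ?_
  rw [← Finset.mul_prod_erase _ _ hj, Matrix.updateCol_self, smul_eq_mul, mul_comm]
  congr 1
  refine Finset.prod_congr rfl fun i hi => ?_
  rw [Matrix.updateCol_ne (Finset.ne_of_mem_erase hi)]

/-- The matrix of the moments `μ_{r i + c j}`. -/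
noncomputable def momentMatrix {ι κ : Type*} (lam : ℝ) (r : ι → ℕ) (c : κ → ℕ) (t : ℝ) :
    Matrix ι κ ℝ :=
  Matrix.of fun i j => moment lam (r i + c j) t

/-- The Hankel matrix of size `m`, bordered by a row of index `k` and a column of index `l`. -/
noncomputable def borderedDet (lam : ℝ) (m k l : ℕ) (t : ℝ) : ℝ :=
  (momentMatrix lam (Sum.elim (fun i : Fin m => (i : ℕ)) fun _ : Fin 1 => k)
    (Sum.elim (fun i : Fin m => (i : ℕ)) fun _ : Fin 1 => l) t).det

theorem borderedDet_comm (lam : ℝ) (m k l : ℕ) (t : ℝ) :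
    borderedDet lam m k l t = borderedDet lam m l k t := by
  rw [borderedDet, ← Matrix.det_transpose]
  congr 1
  ext i j
  simp [momentMatrix, add_comm]

/-- Differentiating a column raises its index by one. For a column other than the border this
reproduces the next column, so the determinant vanishes; only the border column contributes. -/
theorem hasDerivAt_borderedDet {lam : ℝ} (hlam : -1 < lam) (m k : ℕ) (t : ℝ) :
    HasDerivAt (borderedDet lam m k m) (borderedDet lam m k (m + 1) t) t := by
  set r : Fin m ⊕ Fin 1 → ℕ := Sum.elim (fun i : Fin m => (i : ℕ)) fun _ : Fin 1 => k
  set c : Fin m ⊕ Fin 1 → ℕ := Sum.elim (fun i : Fin m => (i : ℕ)) fun _ : Fin 1 => m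
  have h := hasDerivAt_det (A := momentMatrix lam r c)
    (A' := Matrix.of fun i j => moment lam (r i + c j + 1) t) (t := t)
    fun i j => hasDerivAt_moment hlam (r i + c j) t
  refine h.congr_deriv ?_
  rw [Fintype.sum_sum_type, Finset.sum_eq_zero, zero_add, Fin.sum_univ_one, borderedDet]
  · congr 1
    ext i j
    rcases j with j | j
    · simp [momentMatrix, c, r]
    · simp [momentMatrix, r, c, Subsingleton.elim j 0, add_assoc]
  · intro i _
    obtain ⟨j', hne, hj'⟩ : ∃ j', j' ≠ Sum.inl i ∧ c j' = i + 1 := by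
      rcases Nat.lt_or_ge (i + 1) m with hi | hi
      · exact ⟨Sum.inl ⟨i + 1, hi⟩, by simp [Fin.ext_iff], rfl⟩
      · exact ⟨Sum.inr 0, by simp, by simp only [c, Sum.elim_inr]; omega⟩
    refine Matrix.det_zero_of_column_eq hne fun a => ?_
    rw [Matrix.updateCol_self, Matrix.updateCol_ne hne]
    simp [momentMatrix, hj', c, add_assoc]

/-- Schur complement of the invertible Hankel block. Its entries σ depend on each bordering row and
column index alone, so one σ serves for every border size p. -/
theorem det_momentMatrix_sumElim {lam : ℝ} (hlam : -1 < lam) (m : ℕ) (t : ℝ) :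
    ∃ σ : ℕ → ℕ → ℝ, ∀ (p : ℕ) (k l : Fin p → ℕ),
      (momentMatrix lam (Sum.elim (fun i : Fin m => (i : ℕ)) k)
        (Sum.elim (fun i : Fin m => (i : ℕ)) l) t).det
        = hankelDet lam m t * (Matrix.of fun i j => σ (k i) (l j)).det := by
  set A : Matrix (Fin m) (Fin m) ℝ := momentMatrix lam (fun i => (i : ℕ)) (fun i => (i : ℕ)) t
  have hA : IsUnit A.det := (hankelDet_pos hlam m t).ne'.isUnit
  have : Invertible A := A.invertibleOfIsUnitDet hA
  refine ⟨fun k l => moment lam (k + l) t - ∑ j, (∑ i, moment lam (k + (i : Fin m)) t * (⅟A) i j)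
    * moment lam ((j : ℕ) + l) t, fun p k l => ?_⟩
  have hblock : momentMatrix lam (Sum.elim (fun i : Fin m => (i : ℕ)) k)
      (Sum.elim (fun i : Fin m => (i : ℕ)) l) t
      = Matrix.fromBlocks A (momentMatrix lam (fun i => (i : ℕ)) l t)
        (momentMatrix lam k (fun i => (i : ℕ)) t) (momentMatrix lam k l t) := by
    ext i j
    rcases i with i | i <;> rcases j with j | j <;> rfl
  rw [hblock, Matrix.det_fromBlocks₁₁]
  congr 2

theorem hankelDet_add (lam : ℝ) (m p : ℕ) (t : ℝ) :
    hankelDet lam (m + p) t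
      = (momentMatrix lam (Sum.elim (fun i : Fin m => (i : ℕ)) fun i : Fin p => m + i)
        (Sum.elim (fun i : Fin m => (i : ℕ)) fun i : Fin p => m + i) t).det := by
  rw [hankelDet, ← Matrix.det_submatrix_equiv_self finSumFinEquiv]
  congr 1
  ext i j
  rcases i with i | i <;> rcases j with j | j <;> simp [momentMatrix]

theorem hankelDet_succ (lam : ℝ) (m : ℕ) (t : ℝ) :
    hankelDet lam (m + 1) t = borderedDet lam m m m t := by
  rw [hankelDet_add, borderedDet]
  simp

/-- The Toda equation. -/
theorem hankelDet_toda {lam : ℝ} (hlam : -1 < lam) (m : ℕ) :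
    ∃ d d' : ℝ → ℝ, (∀ t, HasDerivAt (hankelDet lam (m + 1)) (d t) t) ∧
      (∀ t, HasDerivAt d (d' t) t) ∧ ∀ t, hankelDet lam (m + 2) t * hankelDet lam m t
        = hankelDet lam (m + 1) t * d' t - d t ^ 2 := by
  have h0 : hankelDet lam (m + 1) = borderedDet lam m m m := funext (hankelDet_succ lam m)
  have h1 : borderedDet lam m m (m + 1) = borderedDet lam m (m + 1) m :=
    funext (borderedDet_comm lam m m (m + 1))
  refine ⟨borderedDet lam m m (m + 1), borderedDet lam m (m + 1) (m + 1), fun t => ?_, fun t => ?_,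
    fun t => ?_⟩
  · rw [h0]
    exact hasDerivAt_borderedDet hlam m m t
  · rw [h1]
    exact hasDerivAt_borderedDet hlam m (m + 1) t
  -- After division by D_m the Toda equation, a Desnanot–Jacobi identity, is just the formula for a
  -- 2 × 2 determinant of σ's.
  · obtain ⟨σ, hσ⟩ := det_momentMatrix_sumElim hlam m t
    rw [hankelDet_add, hσ 2, h0, sq]
    nth_rewrite 2 [h1]
    unfold borderedDet
    simp only [hσ 1, Matrix.det_fin_two, Matrix.det_fin_one, Matrix.of_apply, Fin.val_zero,
      Fin.val_one, add_zero]
    ring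

/-- The Toda equation for `log D_n`. -/
theorem log_hankelDet_toda {lam : ℝ} (hlam : -1 < lam) (m : ℕ) :
    ∃ l l' : ℝ → ℝ, (∀ t, HasDerivAt (fun t => Real.log (hankelDet lam (m + 1) t)) (l t) t) ∧
      (∀ t, HasDerivAt l (l' t) t) ∧ ∀ t, Real.log (hankelDet lam (m + 2) t) =
        2 * Real.log (hankelDet lam (m + 1) t) - Real.log (hankelDet lam m t)
          + Real.log (l' t) := by
  obtain ⟨d, d', h1, h2, h3⟩ := hankelDet_toda hlam m
  have hpos := fun n t => hankelDet_pos hlam n t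
  refine ⟨fun t => d t / hankelDet lam (m + 1) t, fun t => (d' t * hankelDet lam (m + 1) t
    - d t * d t) / hankelDet lam (m + 1) t ^ 2, fun t => (h1 t).log (hpos _ _).ne',
    fun t => (h2 t).div (h1 t) (hpos _ _).ne', fun t => ?_⟩
  have h4 : d' t * hankelDet lam (m + 1) t - d t * d t
      = hankelDet lam (m + 2) t * hankelDet lam m t := by
    rw [h3]
    ring
  simp only [h4]
  rw [Real.log_div (mul_pos (hpos _ _) (hpos _ _)).ne' (pow_pos (hpos _ _) 2).ne',
    Real.log_mul (hpos _ _).ne' (hpos _ _).ne', Real.log_pow]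
  push_cast
  ring

end Toda

/-! ### The functional equation of the Barnes function -/

section Barnes

/-- The factors of the Weierstrass product of `G (1 + w)`. -/
noncomputable def barnesFactor (w : ℝ) (k : ℕ) : ℝ :=
  (1 + w / ((k : ℝ) + 1)) ^ (k + 1) * Real.exp (w ^ 2 / (2 * ((k : ℝ) + 1)) - w)

theorem barnesFactor_pos {w : ℝ} (hw : -1 < w) (k : ℕ) : 0 < barnesFactor w k := by
  have hk : (0 : ℝ) < (k : ℝ) + 1 := by positivity
  have : 0 < 1 + w / ((k : ℝ) + 1) := by
    rw [one_add_div hk.ne']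
    exact div_pos (by linarith [Nat.cast_nonneg (α := ℝ) k]) hk
  unfold barnesFactor
  positivity

/-- The exponential factor cancels the first two Taylor terms of (k + 1) log(1 + w / (k + 1)),
leaving (k + 1) · O((k + 1)⁻³). -/
theorem summable_log_barnesFactor {w : ℝ} (hw : -1 < w) :
    Summable fun k => Real.log (barnesFactor w k) := by
  have ht : Tendsto (fun k : ℕ => w / ((k : ℝ) + 1)) atTop (nhds 0) :=
    tendsto_const_nhds.div_atTop (tendsto_atTop_add_const_right _ _ tendsto_natCast_atTop_atTop)
  have hO : (fun x : ℝ => Real.log (1 + x) - (x - x ^ 2 / 2)) =O[nhds 0] fun x : ℝ => x ^ 3 := by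
    refine IsBigO.of_bound 2 ?_
    filter_upwards [Metric.ball_mem_nhds (0 : ℝ) (show (0 : ℝ) < 1 / 2 by norm_num)] with x hx
    have hx' : |x| < 1 / 2 := by simpa using hx
    have := Real.abs_log_sub_add_sum_range_le (x := -x) (by rw [abs_neg]; linarith) 2
    norm_num [Finset.sum_range_succ] at this
    rw [Real.norm_eq_abs, Real.norm_eq_abs, abs_pow]
    have h2 : |x| ^ 3 / (1 - |x|) ≤ 2 * |x| ^ 3 := by
      rw [div_le_iff₀ (by linarith)]
      nlinarith [pow_nonneg (abs_nonneg x) 3]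
    refine le_trans (le_of_eq ?_) (this.trans h2)
    congr 1
    ring
  have h1 := hO.comp_tendsto ht
  refine summable_of_isBigO_nat (g := fun k : ℕ => 1 / ((k : ℝ) + 1) ^ 2) ?_ ?_
  · have := (summable_nat_add_iff 1).2 (Real.summable_one_div_nat_pow.2 (one_lt_two))
    simpa using this
  · have h2 : (fun k => Real.log (barnesFactor w k)) = fun k : ℕ => ((k : ℝ) + 1) *
        ((fun x : ℝ => Real.log (1 + x) - (x - x ^ 2 / 2)) ∘ fun k : ℕ => w / ((k : ℝ) + 1)) k := by
      funext k
      have hk : (0 : ℝ) < (k : ℝ) + 1 := by positivity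
      have : 0 < 1 + w / ((k : ℝ) + 1) := by
        rw [one_add_div hk.ne']
        exact div_pos (by linarith [Nat.cast_nonneg (α := ℝ) k]) hk
      rw [barnesFactor, Real.log_mul (by positivity) (Real.exp_pos _).ne', Real.log_pow,
        Real.log_exp]
      simp only [Function.comp]
      push_cast
      field_simp
      ring
    rw [h2]
    refine ((isBigO_refl (fun k : ℕ => (k : ℝ) + 1) atTop).mul h1).trans ?_
    refine IsBigO.of_bound (|w| ^ 3) (.of_forall fun k => ?_)
    have hk : (0 : ℝ) < (k : ℝ) + 1 := by positivity
    simp only [Function.comp, norm_mul, norm_div, norm_pow, Real.norm_eq_abs, abs_of_pos hk,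
      abs_one]
    refine le_of_eq ?_
    field_simp

theorem tendsto_prod_barnesFactor {w : ℝ} (hw : -1 < w) :
    Tendsto (fun N => ∏ k ∈ Finset.range N, barnesFactor w k) atTop
      (nhds (∏' k, barnesFactor w k)) :=
  (Real.multipliable_of_summable_log (barnesFactor_pos hw)
    (summable_log_barnesFactor hw)).hasProd.tendsto_prod_nat

theorem barnesG_eq (w : ℝ) : barnesG (w + 1) = (2 * Real.pi) ^ (w / 2) *
    Real.exp (-(w + w ^ 2 * (1 + Real.eulerMascheroniConstant)) / 2) *
      ∏' k, barnesFactor w k := by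
  simp [barnesG, barnesFactor]

theorem tprod_barnesFactor_pos {w : ℝ} (hw : -1 < w) : 0 < ∏' k, barnesFactor w k := by
  rw [← Real.rexp_tsum_eq_tprod (barnesFactor_pos hw) (summable_log_barnesFactor hw)]
  exact Real.exp_pos _

theorem barnesG_pos {z : ℝ} (hz : 0 < z) : 0 < barnesG z := by
  obtain ⟨w, rfl⟩ : ∃ w, z = w + 1 := ⟨z - 1, by ring⟩
  rw [barnesG_eq]
  have := tprod_barnesFactor_pos (w := w) (by linarith)
  positivity

theorem barnesG_one : barnesG 1 = 1 := by
  simp [barnesG]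

/-- The partial products at s and s - 1 have bases (s + k + 1) / (k + 1) and (s + k) / (k + 1), so
their quotient telescopes; the exponents add up to a harmonic number. -/
theorem prod_barnesFactor_ratio {s : ℝ} (hs : 0 < s) (N : ℕ) :
    (∏ k ∈ Finset.range N, barnesFactor s k) * ∏ j ∈ Finset.range N, (s + j)
      = (∏ k ∈ Finset.range N, barnesFactor (s - 1) k) * ((s + N) ^ N *
        Real.exp ((s - 1 / 2) * (harmonic N : ℝ) - N)) := by
  induction N with
  | zero => simp
  | succ N ih =>
    have hN : (0 : ℝ) < (N : ℝ) + 1 := by positivity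
    have hsN : 0 < s + N := by positivity
    rw [Finset.prod_range_succ, Finset.prod_range_succ, Finset.prod_range_succ, harmonic_succ]
    have h1 : barnesFactor s N = ((s + N + 1) / (N + 1)) ^ (N + 1) *
        Real.exp (s ^ 2 / (2 * ((N : ℝ) + 1)) - s) := by
      rw [barnesFactor]
      congr 2
      field_simp
      ring
    have h2 : barnesFactor (s - 1) N = ((s + N) / (N + 1)) ^ (N + 1) *
        Real.exp ((s - 1) ^ 2 / (2 * ((N : ℝ) + 1)) - (s - 1)) := by
      rw [barnesFactor]
      congr 2
      field_simp
      ring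
    have h3 : Real.exp (s ^ 2 / (2 * ((N : ℝ) + 1)) - s) *
        Real.exp ((s - 1 / 2) * (harmonic N : ℝ) - N)
        = Real.exp ((s - 1) ^ 2 / (2 * ((N : ℝ) + 1)) - (s - 1)) *
          Real.exp ((s - 1 / 2) * ((harmonic N : ℝ) + ((N : ℝ) + 1)⁻¹) - (N + 1)) := by
      rw [← Real.exp_add, ← Real.exp_add]
      congr 1
      field_simp
      ring
    calc _ = (∏ k ∈ Finset.range N, barnesFactor s k) * (∏ j ∈ Finset.range N, (s + j)) *
          (barnesFactor s N * (s + N)) := by ring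
      _ = (∏ k ∈ Finset.range N, barnesFactor (s - 1) k) * ((s + N + 1) / (N + 1)) ^ (N + 1) *
          (s + N) ^ (N + 1) * (Real.exp (s ^ 2 / (2 * ((N : ℝ) + 1)) - s) *
            Real.exp ((s - 1 / 2) * (harmonic N : ℝ) - N)) := by
        rw [ih, h1]
        ring
      _ = _ := by
        rw [h3, h2]
        push_cast
        rw [div_pow, div_pow, add_assoc s]
        field_simp

/-- Limit of the finite identity: Gauss's product gives Γ(s), the harmonic number gives γ, and
Stirling's formula gives √(2π). -/
theorem tprod_barnesFactor_eq {s : ℝ} (hs : 0 < s) :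
    ∏' k, barnesFactor s k = (∏' k, barnesFactor (s - 1) k) * (Real.Gamma s *
      (Real.exp (s + (s - 1 / 2) * Real.eulerMascheroniConstant) / √(2 * Real.pi))) := by
  refine tendsto_nhds_unique (tendsto_prod_barnesFactor (by linarith)) ?_
  have hexp := Real.tendsto_one_add_div_pow_exp s
  -- `Real.GammaSeq` has N + 1 factors in its denominator, against N in the finite identity; this
  -- factor accounts for the extra s + N.
  have hone : Tendsto (fun N : ℕ => 1 + s / (N : ℝ)) atTop (nhds (1 + 0)) :=
    tendsto_const_nhds.add (tendsto_const_nhds.div_atTop tendsto_natCast_atTop_atTop)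
  have hharm : Tendsto (fun N : ℕ => Real.exp ((s - 1 / 2) * ((harmonic N : ℝ) - Real.log N)))
      atTop (nhds (Real.exp ((s - 1 / 2) * Real.eulerMascheroniConstant))) :=
    (Real.continuous_exp.tendsto _).comp (Real.tendsto_harmonic_sub_log.const_mul _)
  have hst := (Stirling.tendsto_stirlingSeq_sqrt_pi.const_mul √2).inv₀ (by positivity)
  have hmain := (tendsto_prod_barnesFactor (w := s - 1) (by linarith)).mul
    ((Real.GammaSeq_tendsto_Gamma s).mul (((hexp.mul hone).mul hharm).mul hst))
  have hlim : Real.exp s * (1 + 0) * Real.exp ((s - 1 / 2) * Real.eulerMascheroniConstant) *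
      (√2 * √Real.pi)⁻¹ = Real.exp (s + (s - 1 / 2) * Real.eulerMascheroniConstant) /
        √(2 * Real.pi) := by
    rw [Real.exp_add, Real.sqrt_mul zero_le_two]
    ring
  rw [hlim] at hmain
  refine hmain.congr' ?_
  filter_upwards [eventually_gt_atTop 0] with N hN
  have hN' : (0 : ℝ) < N := Nat.cast_pos.2 hN
  have hprod : 0 < ∏ j ∈ Finset.range N, (s + j) := Finset.prod_pos fun j _ => by positivity
  rw [← mul_left_inj' hprod.ne', prod_barnesFactor_ratio hs, mul_assoc]
  congr 1
  rw [Real.GammaSeq, Finset.prod_range_succ, Stirling.stirlingSeq, Real.sqrt_mul zero_le_two,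
    one_add_div hN'.ne', div_pow, div_pow, mul_sub, Real.exp_sub, Real.exp_sub, mul_comm (s - 1 / 2)
    (Real.log N), ← Real.rpow_def_of_pos hN', Real.rpow_sub hN', ← Real.sqrt_eq_rpow,
    Real.exp_one_pow]
  have h2 : √(N : ℝ) * √(N : ℝ) = N := Real.mul_self_sqrt hN'.le
  have h3 : √(2 : ℝ) * √(2 : ℝ) = 2 := Real.mul_self_sqrt zero_le_two
  have h4 : 0 < √(N : ℝ) := Real.sqrt_pos.2 hN'
  have h5 : (0 : ℝ) < N ^ s := Real.rpow_pos_of_pos hN' s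
  have h6 : (0 : ℝ) < N.factorial := Nat.cast_pos.2 (Nat.factorial_pos N)
  have h7 : 0 < s + N := by positivity
  field_simp
  rw [Real.sq_sqrt hN'.le]
  ring

theorem barnesG_add_one {z : ℝ} (hz : 0 < z) : barnesG (z + 1) = Real.Gamma z * barnesG z := by
  rw [barnesG_eq, tprod_barnesFactor_eq hz]
  obtain ⟨w, rfl⟩ : ∃ w, z = w + 1 := ⟨z - 1, by ring⟩
  rw [barnesG_eq, add_sub_cancel_right, Real.sqrt_eq_rpow, add_div, Real.rpow_add (by positivity)]
  have h : Real.exp (-(w + 1 + (w + 1) ^ 2 * (1 + Real.eulerMascheroniConstant)) / 2) *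
      Real.exp (w + 1 + (w + 1 - 1 / 2) * Real.eulerMascheroniConstant)
      = Real.exp (-(w + w ^ 2 * (1 + Real.eulerMascheroniConstant)) / 2) := by
    rw [← Real.exp_add]
    congr 1
    ring
  rw [← h]
  have : (0 : ℝ) < (2 * Real.pi) ^ (1 / 2 : ℝ) := by positivity
  field_simp

end Barnes

/-! ### Expansions and the operations of the Toda recursion -/

/-- `L (t) = A t ^ p + B log t + C + a t ^ (-q)`, up to a symbol of order `-2q`. -/
def HasExpansion (p q A B C a : ℝ) (L : ℝ → ℝ) : Prop :=
  ∃ R : ℝ → ℝ, IsSymbol (-(2 * q)) R ∧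
    ∀ᶠ t in atTop, L t = A * t ^ p + B * Real.log t + C + a * t ^ (-q) + R t

/-- Factoring out K t^{-e} leaves log(1 + (D / K) t^{-q} + symbol of order -2q). No power term
arises, so p is arbitrary. -/
theorem hasExpansion_log {q K D e : ℝ} (hq : 0 < q) (hK : 0 < K) {f R : ℝ → ℝ}
    (hR : IsSymbol (-e - 2 * q) R)
    (hf : ∀ᶠ t in atTop, f t = K * t ^ (-e) + D * t ^ (-e - q) + R t) (p : ℝ) :
    HasExpansion p q 0 (-e) (Real.log K) (D / K) fun t => Real.log (f t) := by
  have hR' : IsSymbol (-(2 * q)) fun t => K⁻¹ * (t ^ e * R t) :=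
    (((IsSymbol.rpow e).mul hR).const_mul K⁻¹).mono (by linarith)
  refine ⟨_, hR'.log_one_add (c := D / K) hq, ?_⟩
  filter_upwards [hf, hR'.eventually_pos (c := D / K) hq, eventually_gt_atTop 0] with t h1 h2 ht
  have h3 : f t = K * (t ^ (-e) * (1 + (D / K * t ^ (-q) + K⁻¹ * (t ^ e * R t)))) := by
    have h4 : t ^ (-e) * t ^ e = 1 := by rw [← Real.rpow_add ht]; simp
    have h5 : t ^ (-e) * t ^ (-q) = t ^ (-e - q) := by rw [← Real.rpow_add ht]; ring_nf
    have h6 : K * (D / K) = D := mul_div_cancel₀ D hK.ne'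
    have h7 : K * K⁻¹ = 1 := mul_inv_cancel₀ hK.ne'
    linear_combination h1 - D * h5 - t ^ (-e) * t ^ (-q) * h6 - t ^ (-e) * t ^ e * R t * h7
      - R t * h4
  rw [h3, Real.log_mul hK.ne' (mul_pos (Real.rpow_pos_of_pos ht _) h2).ne',
    Real.log_mul (Real.rpow_pos_of_pos ht _).ne' h2.ne', Real.log_rpow ht]
  ring

theorem HasExpansion.second_deriv {p q A B C a : ℝ} {L l l' : ℝ → ℝ}
    (h : HasExpansion p q A B C a L) (hl : ∀ t, HasDerivAt L (l t) t)
    (hl' : ∀ t, HasDerivAt l (l' t) t) :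
    ∃ R : ℝ → ℝ, IsSymbol (-(2 * q) - 2) R ∧ ∀ᶠ t in atTop,
      l' t = A * p * (p - 1) * t ^ (p - 2) - B * t ^ (-2 : ℝ)
        + a * q * (q + 1) * t ^ (-q - 2) + R t := by
  obtain ⟨R, hR, hL⟩ := h
  obtain ⟨R', hR1, hR'⟩ := hR.exists_hasDerivAt
  obtain ⟨R'', hR2, hR''⟩ := hR'.exists_hasDerivAt
  refine ⟨R'', hR''.mono (by linarith), ?_⟩
  have hpow : ∀ {t : ℝ} (_ : 0 < t) (c r : ℝ),
      HasDerivAt (fun t : ℝ => c * t ^ r) (c * (r * t ^ (r - 1))) t := fun ht c r =>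
    (Real.hasDerivAt_rpow_const (Or.inl ht.ne')).const_mul c
  have h1 : l =ᶠ[atTop] fun t => A * p * t ^ (p - 1) + B * t ^ (-1 : ℝ)
      + -(a * q) * t ^ (-q - 1) + R' t := by
    filter_upwards [eventually_eventuallyEq_nhds hL, hR1, eventually_gt_atTop 0] with t e r ht
    have := ((((hpow ht A p).add ((Real.hasDerivAt_log ht.ne').const_mul B)).add_const C).add
      (hpow ht a (-q))).add r
    rw [(hl t).unique (this.congr_of_eventuallyEq e), Real.rpow_neg_one]
    ring
  filter_upwards [eventually_eventuallyEq_nhds h1, hR2, eventually_gt_atTop 0] with t e r ht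
  have := (((hpow ht (A * p) (p - 1)).add (hpow ht B (-1))).add
    (hpow ht (-(a * q)) (-q - 1))).add r
  rw [(hl' t).unique (this.congr_of_eventuallyEq e)]
  rw [show p - 1 - 1 = p - 2 by ring, show (-1 : ℝ) - 1 = -2 by norm_num,
    show -q - 1 - 1 = -q - 2 by ring]
  ring

theorem HasExpansion.toda_step {p q A B C a A₀ B₀ C₀ a₀ A₁ B₁ C₁ a₁ : ℝ} {L L₀ M : ℝ → ℝ}
    (h : HasExpansion p q A B C a L) (h₀ : HasExpansion p q A₀ B₀ C₀ a₀ L₀)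
    (h₁ : HasExpansion p q A₁ B₁ C₁ a₁ M) {N : ℝ → ℝ}
    (hN : ∀ t, N t = 2 * L t - L₀ t + M t) :
    HasExpansion p q (2 * A - A₀ + A₁) (2 * B - B₀ + B₁) (2 * C - C₀ + C₁) (2 * a - a₀ + a₁)
      N := by
  obtain ⟨R, hR, hL⟩ := h
  obtain ⟨R₀, hR₀, hL₀⟩ := h₀
  obtain ⟨R₁, hR₁, hL₁⟩ := h₁
  refine ⟨_, ((hR.const_mul 2).add (hR₀.const_mul (-1))).add hR₁, ?_⟩
  filter_upwards [hL, hL₀, hL₁] with t e e₀ e₁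
  rw [hN, e, e₀, e₁]
  ring

theorem hasExpansion_zero (p q : ℝ) {L : ℝ → ℝ} (h : ∀ t, L t = 0) :
    HasExpansion p q 0 0 0 0 L :=
  ⟨_, .zero _, .of_forall fun t => by simp [h]⟩

theorem hankelDet_zero (lam t : ℝ) : hankelDet lam 0 t = 1 := by
  simp [hankelDet]

theorem hankelDet_one (lam t : ℝ) : hankelDet lam 1 t = moment lam 0 t := by
  simp [hankelDet]

/-! ### The expansion at -∞ -/

section AtBot

theorem abs_exp_neg_sub_le {y : ℝ} (hy : 0 ≤ y) : |Real.exp (-y) - 1 + y| ≤ y ^ 2 := by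
  have h1 := Real.add_one_le_exp (-y)
  have h2 : Real.exp (-y) ≤ (1 + y)⁻¹ := by
    rw [Real.exp_neg]
    exact inv_anti₀ (by linarith) (by linarith [Real.add_one_le_exp y])
  have h3 : (1 + y)⁻¹ ≤ 1 - y + y ^ 2 := by
    rw [inv_le_iff_one_le_mul₀ (by linarith)]
    nlinarith [pow_nonneg hy 3]
  rw [abs_of_nonneg (by linarith)]
  linarith

theorem integrableOn_rpow_mul_exp_neg {a s : ℝ} (ha : -1 < a) (hs : 0 < s) :
    IntegrableOn (fun x : ℝ => x ^ a * Real.exp (-(s * x))) (Set.Ioi 0) := by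
  simpa using integrableOn_rpow_mul_exp_neg_mul_rpow ha one_pos hs

theorem integral_rpow_mul_exp_neg {a s : ℝ} (ha : -1 < a) (hs : 0 < s) :
    ∫ x in Set.Ioi (0 : ℝ), x ^ a * Real.exp (-(s * x)) = Real.Gamma (a + 1) * s ^ (-(a + 1)) := by
  have := Real.integral_rpow_mul_exp_neg_mul_Ioi (a := a + 1) (r := s) (by linarith) hs
  rw [add_sub_cancel_right] at this
  rw [this, one_div, Real.inv_rpow hs.le, Real.rpow_neg hs.le]
  ring

/-- The remainder of second order of `e ^ (-x ^ 3 / 3)`, times `x ^ λ`. -/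
noncomputable def cubicRemainder (lam x : ℝ) : ℝ :=
  x ^ lam * (Real.exp (-(x ^ 3 / 3)) - 1 + x ^ 3 / 3)

theorem abs_cubicRemainder_le (lam : ℝ) {x : ℝ} (hx : 0 < x) :
    |cubicRemainder lam x| ≤ x ^ (lam + 6) := by
  have h := abs_exp_neg_sub_le (y := x ^ 3 / 3) (by positivity)
  rw [cubicRemainder, abs_mul, abs_of_pos (Real.rpow_pos_of_pos hx lam), Real.rpow_add hx]
  refine mul_le_mul_of_nonneg_left (h.trans ?_) (Real.rpow_nonneg hx.le _)
  have : x ^ (6 : ℝ) = x ^ 6 := by exact_mod_cast Real.rpow_natCast x 6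
  rw [this]
  nlinarith [pow_pos hx 6]

/-- The amplitude is at most x^{λ+6}, whose Laplace transform has order -(λ + 7), that is s^{-6}
relative to the leading term s^{-(λ+1)}. -/
theorem laplaceBound_cubicRemainder {lam : ℝ} (hlam : -1 < lam) :
    LaplaceBound (volume.restrict (Set.Ioi (0 : ℝ))) (fun x => x) (cubicRemainder lam)
      (-(lam + 7)) := by
  have hmeas : AEStronglyMeasurable (cubicRemainder lam) (volume.restrict (Set.Ioi (0 : ℝ))) := by
    unfold cubicRemainder
    exact Measurable.aestronglyMeasurable (by fun_prop)
  refine ⟨hmeas, Real.Gamma (lam + 6 + 1), ?_⟩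
  filter_upwards [eventually_gt_atTop 0] with s hs
  have h6 := integrableOn_rpow_mul_exp_neg (a := lam + 6) (by linarith) hs
  have hle : ∀ᵐ x ∂volume.restrict (Set.Ioi (0 : ℝ)),
      |cubicRemainder lam x| * Real.exp (-(s * x)) ≤ x ^ (lam + 6) * Real.exp (-(s * x)) :=
    (ae_restrict_mem measurableSet_Ioi).mono fun x hx =>
      mul_le_mul_of_nonneg_right (abs_cubicRemainder_le lam hx) (Real.exp_nonneg _)
  have hint : Integrable (fun x => cubicRemainder lam x * Real.exp (-(s * x)))
      (volume.restrict (Set.Ioi (0 : ℝ))) := by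
    refine h6.mono' (hmeas.mul (by fun_prop)) ?_
    simpa [abs_mul] using hle
  refine ⟨hint, ?_⟩
  calc _ ≤ ∫ x in Set.Ioi (0 : ℝ), x ^ (lam + 6) * Real.exp (-(s * x)) :=
        integral_mono_ae (by simpa [abs_mul] using hint.abs) h6 hle
    _ = _ := by
      rw [integral_rpow_mul_exp_neg (by linarith) hs]
      ring_nf

theorem moment_zero_neg {lam s : ℝ} (hlam : -1 < lam) (hs : 0 < s) :
    moment lam 0 (-s) = Real.Gamma (lam + 1) * s ^ (-(lam + 1))
      + -(Real.Gamma (lam + 4) / 3) * s ^ (-(lam + 1) - 3)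
      + ∫ x in Set.Ioi (0 : ℝ), cubicRemainder lam x * Real.exp (-(s * x)) := by
  have h0 := integrableOn_rpow_mul_exp_neg hlam hs
  have h3 := integrableOn_rpow_mul_exp_neg (a := lam + 3) (by linarith) hs
  have hpoint : Set.EqOn (fun x => cubicRemainder lam x * Real.exp (-(s * x)))
      (fun x => x ^ 0 * weight lam (-s) x - x ^ lam * Real.exp (-(s * x))
        + 1 / 3 * (x ^ (lam + 3) * Real.exp (-(s * x)))) (Set.Ioi 0) := fun x hx => by
    have hx : 0 < x := hx
    have h : x ^ (3 : ℝ) = x ^ 3 := by exact_mod_cast Real.rpow_natCast x 3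
    simp only [cubicRemainder, weight, Real.rpow_add hx, h]
    rw [show -(x ^ 3) / 3 + -s * x = -(x ^ 3 / 3) + -(s * x) by ring, Real.exp_add]
    ring
  rw [setIntegral_congr_fun measurableSet_Ioi hpoint, integral_add, integral_sub,
    integral_const_mul, integral_rpow_mul_exp_neg hlam hs,
    integral_rpow_mul_exp_neg (by linarith) hs, moment]
  · ring_nf
  · exact integrableOn_pow_mul_weight hlam 0 (-s)
  · exact h0
  · exact (integrableOn_pow_mul_weight hlam 0 (-s)).sub h0
  · exact h3.const_mul _

theorem hasExpansion_log_moment_atBot {lam : ℝ} (hlam : -1 < lam) :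
    HasExpansion 1 3 0 (-(lam + 1)) (Real.log (Real.Gamma (lam + 1)))
      (-((lam + 1) * (lam + 2) * (lam + 3) / 3)) fun s => Real.log (moment lam 0 (-s)) := by
  have hΓ : 0 < Real.Gamma (lam + 1) := Real.Gamma_pos_of_pos (by linarith)
  have hR : IsSymbol (-(lam + 1) - 2 * 3) fun s => ∫ x in Set.Ioi (0 : ℝ),
      cubicRemainder lam x * Real.exp (-(s * x)) :=
    ((laplaceBound_cubicRemainder hlam).isSymbol (by fun_prop)
      ((ae_restrict_mem measurableSet_Ioi).mono fun x hx => le_of_lt hx)).mono (by linarith)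
  have h4 : Real.Gamma (lam + 4) = (lam + 3) * ((lam + 2) * ((lam + 1) * Real.Gamma (lam + 1))) := by
    rw [← Real.Gamma_add_one (by linarith), show lam + 1 + 1 = lam + 2 by ring,
      ← Real.Gamma_add_one (by linarith), show lam + 2 + 1 = lam + 3 by ring,
      ← Real.Gamma_add_one (by linarith)]
    ring_nf
  have := hasExpansion_log (p := 1) (by norm_num) hΓ hR
    (f := fun s => moment lam 0 (-s)) (D := -(Real.Gamma (lam + 4) / 3)) ?_
  · convert this using 1
    rw [h4]
    field_simp
  · filter_upwards [eventually_gt_atTop 0] with s hs using moment_zero_neg hlam hs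

theorem hasExpansion_atBot {lam : ℝ} (hlam : -1 < lam) (n : ℕ) :
    HasExpansion 1 3 0 (-((n : ℝ) * ((n : ℝ) + lam)))
      (Real.log (barnesG ((n : ℝ) + 1) * barnesG ((n : ℝ) + lam + 1) / barnesG (lam + 1)))
      (-((n : ℝ) * ((n : ℝ) + lam) *
        (5 * (n : ℝ) ^ 2 + 5 * (n : ℝ) * lam + lam ^ 2 + 1) / 3))
      fun s => Real.log (hankelDet lam n (-s)) := by
  have hG : barnesG (lam + 1) ≠ 0 := (barnesG_pos (by linarith)).ne'
  have hC : ∀ k : ℕ, Real.log (barnesG ((k : ℝ) + 1) * barnesG ((k : ℝ) + lam + 1) /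
      barnesG (lam + 1)) = Real.log (barnesG ((k : ℝ) + 1)) + Real.log (barnesG ((k : ℝ) + lam + 1))
        - Real.log (barnesG (lam + 1)) := fun k => by
    have h0 : (0 : ℝ) ≤ k := Nat.cast_nonneg k
    have h1 : barnesG ((k : ℝ) + 1) ≠ 0 := (barnesG_pos (by linarith)).ne'
    have h2 : barnesG ((k : ℝ) + lam + 1) ≠ 0 := (barnesG_pos (by linarith)).ne'
    rw [Real.log_div (mul_ne_zero h1 h2) hG, Real.log_mul h1 h2]
  have hstep : ∀ z : ℝ, 0 < z →
      Real.log (barnesG (z + 1)) = Real.log (Real.Gamma z) + Real.log (barnesG z) := fun z hz => by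
    rw [barnesG_add_one hz, Real.log_mul (Real.Gamma_pos_of_pos hz).ne' (barnesG_pos hz).ne']
  have hΓ : ∀ z : ℝ, 0 < z →
      Real.log (Real.Gamma (z + 1)) = Real.log z + Real.log (Real.Gamma z) := fun z hz => by
    rw [Real.Gamma_add_one hz.ne', Real.log_mul hz.ne' (Real.Gamma_pos_of_pos hz).ne']
  induction n using Nat.twoStepInduction with
  | zero =>
    convert! hasExpansion_zero 1 3 (L := fun s => Real.log (hankelDet lam 0 (-s)))
      fun s => by simp [hankelDet_zero] using 1
    · simp
    · simp [barnesG_one, div_self hG]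
    · simp
  | one =>
    have h2 : barnesG 2 = 1 := by
      have := barnesG_add_one one_pos
      rwa [Real.Gamma_one, barnesG_one, one_mul, one_add_one_eq_two] at this
    convert! hasExpansion_log_moment_atBot hlam using 1
    · push_cast
      ring
    · rw [Nat.cast_one, one_add_one_eq_two, h2, add_comm 1 lam, barnesG_add_one (by linarith)]
      field_simp
    · push_cast
      ring
    · simp only [hankelDet_one]
  | more k h₀ h =>
    have hk : (0 : ℝ) ≤ k := Nat.cast_nonneg k
    obtain ⟨l, l', hl, hl', hN⟩ := log_hankelDet_toda hlam k
    -- In the variable s = -t the first derivative changes sign and the second does not.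
    obtain ⟨R, hR, hR'⟩ := h.second_deriv (l := fun s => -l (-s)) (l' := fun s => l' (-s))
      (fun s => ((hl (-s)).scomp s (hasDerivAt_neg s)).congr_deriv (by simp))
      (fun s => (((hl' (-s)).scomp s (hasDerivAt_neg s)).neg).congr_deriv (by simp))
    push_cast at h h₀ hR' ⊢
    -- Here A = 0, so the second derivative is led by -B s^{-2}, whence K = -B; D = 12 a, with 12 =
    -- q (q + 1).
    have hlog := hasExpansion_log (p := 1) (q := 3) (K := (k + 1) * (k + 1 + lam)) (e := 2)
      (D := -((k + 1) * (k + 1 + lam) *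
        (5 * ((k : ℝ) + 1) ^ 2 + 5 * (k + 1) * lam + lam ^ 2 + 1) / 3) * 12)
      (by norm_num) (mul_pos (by linarith) (by linarith)) (hR.mono (by norm_num)) ?_
      (f := fun s => l' (-s))
    · have := h.toda_step h₀ hlog fun s => hN (-s)
      convert! this using 1
      · ring
      · ring
      · have hC0 := hC k
        have hC1 := hC (k + 1)
        have hC2 := hC (k + 2)
        push_cast at hC1 hC2
        rw [hC0, hC1, hC2, Real.log_mul (by linarith) (by linarith),
          show (k : ℝ) + 2 + 1 = k + 1 + 1 + 1 by ring,
          show (k : ℝ) + 2 + lam + 1 = k + lam + 1 + 1 + 1 by ring,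
          show (k : ℝ) + 1 + lam + 1 = k + lam + 1 + 1 by ring,
          show (k : ℝ) + 1 + lam = k + lam + 1 by ring,
          hstep _ (by linarith), hstep _ (by linarith), hstep (k + lam + 1 + 1) (by linarith),
          hstep (k + lam + 1) (by linarith), hΓ (k + 1) (by linarith),
          hΓ (k + lam + 1) (by linarith)]
        ring
      · have h1 : (k : ℝ) + 1 ≠ 0 := by linarith
        have h2 : (k : ℝ) + 1 + lam ≠ 0 := by linarith
        field_simp
        ring
    · filter_upwards [hR'] with t ht
      rw [ht, show (-2 : ℝ) - 3 = -3 - 2 by norm_num]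
      ring

end AtBot

/-! ### Gaussian moments -/

section Gaussian

theorem integrable_pow_mul_exp_neg_mul_sq {b : ℝ} (hb : 0 < b) (k : ℕ) :
    Integrable fun v : ℝ => v ^ k * Real.exp (-(b * v ^ 2)) := by
  have := integrable_rpow_mul_exp_neg_mul_sq hb (s := k) (by linarith [Nat.cast_nonneg (α := ℝ) k])
  simpa using this

theorem integral_abs_pow_mul_exp_neg_mul_sq {b : ℝ} (hb : 0 < b) (k : ℕ) :
    ∫ v : ℝ, |v| ^ k * Real.exp (-(b * v ^ 2))
      = Real.Gamma (((k : ℝ) + 1) / 2) * b ^ (-((k : ℝ) + 1) / 2) := by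
  have h1 := integral_comp_abs (f := fun v : ℝ => v ^ k * Real.exp (-(b * v ^ 2)))
  simp only [sq_abs] at h1
  have h2 := integral_rpow_mul_exp_neg_mul_rpow (p := 2) (q := k) (b := b) two_pos
    (by linarith [Nat.cast_nonneg (α := ℝ) k]) hb
  rw [h1]
  simp only [Real.rpow_natCast, Real.rpow_two, neg_mul] at h2
  rw [h2]
  ring

/-- The Gaussian integral of a cubic polynomial. -/
theorem integral_cubic_mul_exp_neg_mul_sq {τ : ℝ} (hτ : 0 < τ) (b e d : ℝ) :
    ∫ v : ℝ, (1 + b * v + e * v ^ 2 + d * v ^ 3) * Real.exp (-(τ * v ^ 2))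
      = √Real.pi * τ ^ (-(1 / 2) : ℝ) + e * √Real.pi / 2 * τ ^ (-(1 / 2) - 1 : ℝ) := by
  have hi := integrable_pow_mul_exp_neg_mul_sq hτ
  have h0 := integral_abs_pow_mul_exp_neg_mul_sq hτ 0
  have h2 := integral_abs_pow_mul_exp_neg_mul_sq hτ 2
  have hodd : ∀ k : ℕ, Odd k → ∫ v : ℝ, v ^ k * Real.exp (-(τ * v ^ 2)) = 0 := fun k hk => by
    have := integral_neg_eq_self (fun v : ℝ => v ^ k * Real.exp (-(τ * v ^ 2))) volume
    simp only [hk.neg_pow, even_two.neg_pow, neg_mul, integral_neg] at this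
    linarith
  have hpoint : ∀ v : ℝ, (1 + b * v + e * v ^ 2 + d * v ^ 3) * Real.exp (-(τ * v ^ 2))
      = v ^ 0 * Real.exp (-(τ * v ^ 2)) + b * (v ^ 1 * Real.exp (-(τ * v ^ 2)))
        + e * (v ^ 2 * Real.exp (-(τ * v ^ 2))) + d * (v ^ 3 * Real.exp (-(τ * v ^ 2))) :=
    fun v => by ring
  simp_rw [hpoint]
  have i1 : Integrable fun v : ℝ => v ^ 0 * Real.exp (-(τ * v ^ 2)) +
      b * (v ^ 1 * Real.exp (-(τ * v ^ 2))) := (hi 0).add ((hi 1).const_mul b)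
  have i2 : Integrable fun v : ℝ => v ^ 0 * Real.exp (-(τ * v ^ 2)) +
      b * (v ^ 1 * Real.exp (-(τ * v ^ 2))) + e * (v ^ 2 * Real.exp (-(τ * v ^ 2))) :=
    i1.add ((hi 2).const_mul e)
  rw [integral_add i2 ((hi 3).const_mul d), integral_add i1 ((hi 2).const_mul e),
    integral_add (hi 0) ((hi 1).const_mul b), integral_const_mul, integral_const_mul,
    integral_const_mul, hodd 1 odd_one, hodd 3 (by decide)]
  simp only [sq_abs, pow_zero] at h0 h2 ⊢
  rw [h0, h2]
  have hΓ : Real.Gamma ((((2 : ℕ) : ℝ) + 1) / 2) = √Real.pi / 2 := by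
    rw [show (((2 : ℕ) : ℝ) + 1) / 2 = 1 / 2 + 1 by norm_num, Real.Gamma_add_one (by norm_num),
      Real.Gamma_one_half_eq]
    ring
  rw [hΓ]
  norm_num [Real.Gamma_one_half_eq]
  ring_nf

end Gaussian

/-! ### Laplace's method with an amplitude vanishing at the minimum -/

section Laplace

/-- Laplace's method: the amplitude vanishes to fourth order at the minimum of the phase. -/
theorem laplaceBound_of_le_pow_four {s : Set ℝ} (hs : MeasurableSet s) {φ g : ℝ → ℝ} {x₀ κ δ C : ℝ}
    (hκ : 0 < κ) (hδ : 0 < δ) (hC : 0 ≤ C) (hφm : AEStronglyMeasurable φ (volume.restrict s))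
    (hg : IntegrableOn (fun x => g x * Real.exp (-φ x)) s)
    (hgm : AEStronglyMeasurable g (volume.restrict s))
    (hφ : ∀ x ∈ s, κ * (x - x₀) ^ 2 ≤ φ x)
    (hle : ∀ x ∈ s, |x - x₀| < δ → |g x| ≤ C * |x - x₀| ^ 4) :
    LaplaceBound (volume.restrict s) φ g (-(5 / 2)) := by
  set I : ℝ := ∫ x in s, |g x| * Real.exp (-φ x)
  have hI : 0 ≤ I := integral_nonneg fun x => by positivity
  refine ⟨hgm, C * (Real.Gamma (((4 : ℕ) + 1) / 2) * κ ^ (-(5 / 2) : ℝ))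
    + Real.exp (κ * δ ^ 2) * I, ?_⟩
  have hexp := (isLittleO_exp_neg_mul_rpow_atTop (a := κ * δ ^ 2) (by positivity)
    (-(5 / 2))).bound one_pos
  filter_upwards [eventually_ge_atTop 1, hexp] with τ hτ hτexp
  have hτ0 : 0 < τ := by linarith
  have hgabs : IntegrableOn (fun x => |g x| * Real.exp (-φ x)) s := by
    have := hg.abs
    simp only [abs_mul, Real.abs_exp] at this
    exact this
  have hgauss : Integrable fun x : ℝ => |x - x₀| ^ 4 * Real.exp (-(κ * τ * (x - x₀) ^ 2)) := by
    have h4 : ∀ x : ℝ, |x - x₀| ^ 4 = (x - x₀) ^ 4 := fun x => Even.pow_abs (by decide) _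
    simp_rw [h4]
    exact (integrable_pow_mul_exp_neg_mul_sq (b := κ * τ) (by positivity) 4).comp_sub_right x₀
  have hpoint : ∀ x ∈ s, |g x| * Real.exp (-(τ * φ x))
      ≤ C * (|x - x₀| ^ 4 * Real.exp (-(κ * τ * (x - x₀) ^ 2)))
        + Real.exp (-(κ * δ ^ 2) * (τ - 1)) * (|g x| * Real.exp (-φ x)) := by
    intro x hx
    have h1 := hφ x hx
    -- Near x₀ the fourth Gaussian moment gives τ^{-5/2}; away from it φ ≥ κδ², and the integral at
    -- τ = 1 is multiplied by an exponentially small factor.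
    rcases lt_or_ge |x - x₀| δ with h | h
    · have h2 : Real.exp (-(τ * φ x)) ≤ Real.exp (-(κ * τ * (x - x₀) ^ 2)) := by
        rw [Real.exp_le_exp]
        nlinarith
      have h3 : |g x| * Real.exp (-(τ * φ x))
          ≤ C * |x - x₀| ^ 4 * Real.exp (-(κ * τ * (x - x₀) ^ 2)) :=
        mul_le_mul (hle x hx h) h2 (Real.exp_nonneg _) (by positivity)
      have h4 : 0 ≤ Real.exp (-(κ * δ ^ 2) * (τ - 1)) * (|g x| * Real.exp (-φ x)) := by positivity
      linarith
    · have h2 : δ ^ 2 ≤ (x - x₀) ^ 2 := by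
        rw [← sq_abs (x - x₀)]
        gcongr
      have h3 : κ * δ ^ 2 ≤ φ x := le_trans (by gcongr) h1
      have h4 : Real.exp (-(τ * φ x)) ≤ Real.exp (-(κ * δ ^ 2) * (τ - 1)) * Real.exp (-φ x) := by
        rw [← Real.exp_add, Real.exp_le_exp]
        nlinarith
      have h5 := mul_le_mul_of_nonneg_left h4 (abs_nonneg (g x))
      have h6 : 0 ≤ C * (|x - x₀| ^ 4 * Real.exp (-(κ * τ * (x - x₀) ^ 2))) := by positivity
      linarith
  have hbound : IntegrableOn (fun x => C * (|x - x₀| ^ 4 * Real.exp (-(κ * τ * (x - x₀) ^ 2)))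
      + Real.exp (-(κ * δ ^ 2) * (τ - 1)) * (|g x| * Real.exp (-φ x))) s :=
    (hgauss.integrableOn.const_mul C).add (hgabs.const_mul _)
  have hle' : ∀ᵐ x ∂volume.restrict s, |g x| * Real.exp (-(τ * φ x))
      ≤ C * (|x - x₀| ^ 4 * Real.exp (-(κ * τ * (x - x₀) ^ 2)))
        + Real.exp (-(κ * δ ^ 2) * (τ - 1)) * (|g x| * Real.exp (-φ x)) :=
    (ae_restrict_mem hs).mono hpoint
  have hint : IntegrableOn (fun x => g x * Real.exp (-(τ * φ x))) s := by
    refine hbound.mono' (hgm.mul (Real.continuous_exp.comp_aestronglyMeasurable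
      (hφm.const_mul τ).neg)) ?_
    simpa [abs_mul] using hle'
  refine ⟨hint, ?_⟩
  have hval : ∫ x : ℝ, |x - x₀| ^ 4 * Real.exp (-(κ * τ * (x - x₀) ^ 2))
      = Real.Gamma (((4 : ℕ) + 1) / 2) * κ ^ (-(5 / 2) : ℝ) * τ ^ (-(5 / 2) : ℝ) := by
    rw [integral_sub_right_eq_self (fun x : ℝ => |x| ^ 4 * Real.exp (-(κ * τ * x ^ 2))) x₀,
      integral_abs_pow_mul_exp_neg_mul_sq (by positivity), Real.mul_rpow hκ.le hτ0.le]
    norm_num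
    ring
  calc _ ≤ ∫ x in s, (C * (|x - x₀| ^ 4 * Real.exp (-(κ * τ * (x - x₀) ^ 2)))
        + Real.exp (-(κ * δ ^ 2) * (τ - 1)) * (|g x| * Real.exp (-φ x))) :=
        integral_mono_ae (by simpa [abs_mul] using hint.abs) hbound hle'
    _ = C * (∫ x in s, |x - x₀| ^ 4 * Real.exp (-(κ * τ * (x - x₀) ^ 2)))
        + Real.exp (-(κ * δ ^ 2) * (τ - 1)) * I := by
        rw [integral_add (hgauss.integrableOn.const_mul C) (hgabs.const_mul _),
          integral_const_mul, integral_const_mul]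
    _ ≤ C * (∫ x : ℝ, |x - x₀| ^ 4 * Real.exp (-(κ * τ * (x - x₀) ^ 2)))
        + Real.exp (-(κ * δ ^ 2) * (τ - 1)) * I := by
        refine add_le_add (mul_le_mul_of_nonneg_left ?_ hC) le_rfl
        exact setIntegral_le_integral hgauss (.of_forall fun x => by positivity)
    _ ≤ _ := by
        rw [hval]
        rw [one_mul, Real.norm_of_nonneg (Real.exp_nonneg _),
          Real.norm_of_nonneg (Real.rpow_nonneg hτ0.le _)] at hτexp
        have h7 : Real.exp (-(κ * δ ^ 2) * (τ - 1))
            = Real.exp (κ * δ ^ 2) * Real.exp (-(κ * δ ^ 2) * τ) := by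
          rw [← Real.exp_add]
          ring_nf
        have h8 := mul_le_mul_of_nonneg_left hτexp
          (show 0 ≤ Real.exp (κ * δ ^ 2) * I by positivity)
        rw [h7]
        linarith

end Laplace

/-! ### The phase and the change of variable that makes it a square -/

section Phase

/-- The phase of the generalized Airy weight at its saddle point, after scaling. -/
noncomputable def airyPhase (y : ℝ) : ℝ := (y - 1) ^ 2 * (y + 2) / 3

/-- The square root of the phase. -/
noncomputable def airyRoot (y : ℝ) : ℝ := (y - 1) * √((y + 2) / 3)

/-- The derivative of the square root of the phase. -/
noncomputable def airyRootDeriv (y : ℝ) : ℝ := (y + 1) / (2 * √((y + 2) / 3))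

theorem airyRoot_sq {y : ℝ} (hy : -2 < y) : airyRoot y ^ 2 = airyPhase y := by
  rw [airyRoot, airyPhase, mul_pow, Real.sq_sqrt (by linarith)]
  ring

theorem hasDerivAt_airyRoot {y : ℝ} (hy : -2 < y) :
    HasDerivAt airyRoot (airyRootDeriv y) y := by
  have hpos : 0 < (y + 2) / 3 := by linarith
  have h1 : HasDerivAt (fun y : ℝ => (y + 2) / 3) (1 / 3) y :=
    ((hasDerivAt_id y).add_const 2).div_const 3
  have h2 : HasDerivAt (fun y : ℝ => y - 1) 1 y := (hasDerivAt_id y).sub_const 1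
  refine (h2.mul (h1.sqrt hpos.ne')).congr_deriv ?_
  have h3 : √((y + 2) / 3) * √((y + 2) / 3) = (y + 2) / 3 := Real.mul_self_sqrt hpos.le
  have h4 : 0 < √((y + 2) / 3) := Real.sqrt_pos.2 hpos
  rw [airyRootDeriv]
  generalize √((y + 2) / 3) = r at *
  field_simp
  linear_combination 6 * h3

theorem continuousOn_airyRoot : ContinuousOn airyRoot (Set.Ici 0) := fun y hy =>
  (hasDerivAt_airyRoot
    (lt_of_lt_of_le (by norm_num) (Set.mem_Ici.1 hy))).continuousAt.continuousWithinAt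

theorem strictMonoOn_airyRoot : StrictMonoOn airyRoot (Set.Ici 0) := by
  refine strictMonoOn_of_deriv_pos (convex_Ici 0) continuousOn_airyRoot fun y hy => ?_
  rw [interior_Ici] at hy
  have hy : 0 < y := hy
  rw [(hasDerivAt_airyRoot (by linarith)).deriv, airyRootDeriv]
  positivity

theorem tendsto_airyRoot : Tendsto airyRoot atTop atTop := by
  refine tendsto_atTop_mono' atTop (f₁ := fun y => y - 1) ?_
    (tendsto_atTop_add_const_right _ _ tendsto_id)
  filter_upwards [eventually_ge_atTop 1] with y hy
  have h : 1 ≤ √((y + 2) / 3) := Real.one_le_sqrt.2 (by linarith)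
  rw [airyRoot]
  nlinarith

theorem airyRoot_image : airyRoot '' Set.Ioi 0 = Set.Ioi (airyRoot 0) := by
  ext z
  constructor
  · rintro ⟨y, hy, rfl⟩
    exact strictMonoOn_airyRoot Set.self_mem_Ici (Set.Ioi_subset_Ici_self hy) hy
  · intro hz
    obtain ⟨y, hy, rfl⟩ := isPreconnected_Ici.intermediate_value_Ici Set.self_mem_Ici
      (le_principal_iff.mpr (Ici_mem_atTop 0)) continuousOn_airyRoot tendsto_airyRoot
      (Set.Ioi_subset_Ici_self hz)
    refine ⟨y, Set.mem_Ioi.2 (lt_of_le_of_ne hy ?_), rfl⟩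
    rintro rfl
    exact lt_irrefl _ (Set.mem_Ioi.1 hz)

theorem monotoneOn_airyRoot : MonotoneOn airyRoot (Set.Ioi 0) :=
  strictMonoOn_airyRoot.monotoneOn.mono Set.Ioi_subset_Ici_self

theorem integral_airyRoot (G : ℝ → ℝ) :
    ∫ v in Set.Ioi (airyRoot 0), G v = ∫ y in Set.Ioi (0 : ℝ), airyRootDeriv y * G (airyRoot y) := by
  rw [← airyRoot_image, integral_image_eq_integral_deriv_smul_of_monotoneOn measurableSet_Ioi
    (fun y hy => (hasDerivAt_airyRoot (lt_trans (by norm_num) (Set.mem_Ioi.1 hy))).hasDerivWithinAt)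
    monotoneOn_airyRoot]
  rfl

theorem integrableOn_airyRoot {G : ℝ → ℝ} (hG : Integrable G) :
    IntegrableOn (fun y => airyRootDeriv y * G (airyRoot y)) (Set.Ioi 0) :=
  (integrableOn_image_iff_integrableOn_deriv_smul_of_monotoneOn measurableSet_Ioi
    (fun y hy => (hasDerivAt_airyRoot (lt_trans (by norm_num) (Set.mem_Ioi.1 hy))).hasDerivWithinAt)
    monotoneOn_airyRoot G).1 hG.integrableOn

end Phase

/-! ### Taylor expansion of the amplitude -/

section Taylor

theorem isBigO_one_add_rpow_sub (a : ℝ) :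
    (fun u : ℝ => (1 + u) ^ a - (1 + a * u + a * (a - 1) / 2 * u ^ 2
      + a * (a - 1) * (a - 2) / 6 * u ^ 3)) =O[nhds 0] fun u : ℝ => u ^ 4 := by
  have h := (Real.one_add_rpow_hasFPowerSeriesAt_zero (a := a)).isBigO_sub_partialSum_pow 4
  have h2 := Ring.descPochhammer_eq_factorial_smul_choose a 2
  have h3 := Ring.descPochhammer_eq_factorial_smul_choose a 3
  simp [descPochhammer_succ_right, Polynomial.smeval_mul, Polynomial.smeval_sub,
    Polynomial.smeval_X] at h2
  simp [descPochhammer_succ_right, Polynomial.smeval_mul, Polynomial.smeval_sub,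
    Polynomial.smeval_X, Polynomial.smeval_natCast, -Nat.cast_ofNat, Nat.factorial] at h3
  push_cast at h3
  simp [FormalMultilinearSeries.partialSum, binomialSeries, Finset.sum_range_succ] at h
  refine (h.congr_left fun u => ?_).trans (.of_bound 1 (.of_forall fun u => by simp))
  have h2' : Ring.choose a 2 = a * (a - 1) / 2 := by linarith
  have h3' : Ring.choose a 3 = a * (a - 1) * (a - 2) / 6 := by linarith
  rw [h2', h3']
  ring

/-- The coefficient of `v ^ 2` in the amplitude. -/
noncomputable def airyCoeff (lam : ℝ) : ℝ := lam ^ 2 / 2 - lam + 5 / 24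

/-- The Taylor polynomial of third order of the amplitude, in the variable `v = airyRoot y`. -/
noncomputable def airyCubic (lam v : ℝ) : ℝ :=
  1 + (lam - 1 / 3) * v + airyCoeff lam * v ^ 2
    + (lam * (lam - 1) * (lam - 2) / 6 - 1 / 108 - 2 * airyCoeff lam / 3) * v ^ 3

/-- The remainder of the amplitude. -/
noncomputable def airyRemainder (lam y : ℝ) : ℝ :=
  y ^ lam - airyRootDeriv y * airyCubic lam (airyRoot y)

/-- With y = 1 + u and r = (1 + u/3)^{-1/2}, one has v = u (1 + u/3) r and v' = (1 + u/2) r. The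
relation (1 + u/3) r² = 1 makes v' times the cubic in v affine in r, so the Taylor polynomials of (1
+ u)^λ and r decide the order. -/
theorem isBigO_airyRemainder (lam : ℝ) :
    (fun u : ℝ => airyRemainder lam (1 + u)) =O[nhds 0] fun u : ℝ => u ^ 4 := by
  have h1 := isBigO_one_add_rpow_sub lam
  have hlin : Tendsto (fun u : ℝ => u / 3) (nhds 0) (nhds 0) := by
    simpa using (continuous_id.div_const (3 : ℝ)).tendsto 0
  have h2 := (isBigO_one_add_rpow_sub (-(1 / 2))).comp_tendsto hlin
  have hthird : ((fun u : ℝ => u ^ 4) ∘ fun u : ℝ => u / 3) =O[nhds 0] fun u : ℝ => u ^ 4 := by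
    refine IsBigO.of_bound 1 (.of_forall fun u => ?_)
    simp only [Function.comp, div_pow, norm_div, one_mul]
    exact div_le_self (norm_nonneg _) (by norm_num)
  have h2' := h2.trans hthird
  set e := airyCoeff lam with he
  have he' : e = lam ^ 2 / 2 - lam + 5 / 24 := rfl
  set d := lam * (lam - 1) * (lam - 2) / 6 - 1 / 108 - 2 * e / 3 with hd
  have hbdd : ∀ {f : ℝ → ℝ}, Continuous f → f =O[nhds 0] fun _ : ℝ => (1 : ℝ) := fun hf =>
    (hf.tendsto 0).isBigO_one ℝ
  have h3 := (hbdd (f := fun u : ℝ => (1 + u / 2) * (1 + e * u ^ 2 * (1 + u / 3)))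
    (by fun_prop)).mul h2'
  -- The explicit terms of degree at least 4 left over when r is replaced by its cubic Taylor
  -- polynomial.
  have h4 := (hbdd (f := fun u : ℝ => -(-5 / 864 + 5 * e / 72 + 5 * d / 6 + u * (-e / 216 + d / 6)
    - 7 * e / 2592 * u ^ 2 - 5 * e / 2592 * u ^ 3)) (by fun_prop)).mul
    (isBigO_refl (fun u : ℝ => u ^ 4) (nhds 0))
  simp only [one_mul] at h3 h4
  refine ((h1.sub h3).add h4).congr' ?_ EventuallyEq.rfl
  filter_upwards [lt_mem_nhds (show (-1 : ℝ) < 0 by norm_num)] with u hu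
  have hpos : 0 < 1 + u / 3 := by linarith
  have hs : √((1 + u + 2) / 3) = (1 + u / 3) * (1 + u / 3) ^ (-(1 / 2) : ℝ) := by
    rw [show (1 + u + 2) / 3 = 1 + u / 3 by ring, Real.sqrt_eq_rpow]
    nth_rewrite 2 [← Real.rpow_one (1 + u / 3)]
    rw [← Real.rpow_add hpos]
    norm_num
  have hr : (1 + u / 3) * ((1 + u / 3) ^ (-(1 / 2) : ℝ)) ^ 2 = 1 := by
    rw [← Real.rpow_natCast, ← Real.rpow_mul hpos.le]
    norm_num
    rw [Real.rpow_neg_one, mul_inv_cancel₀ hpos.ne']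
  have hv' : airyRootDeriv (1 + u) = (1 + u / 2) * (1 + u / 3) ^ (-(1 / 2) : ℝ) := by
    rw [airyRootDeriv, hs]
    have h0 : 0 < (1 + u / 3) ^ (-(1 / 2) : ℝ) := Real.rpow_pos_of_pos hpos _
    rw [div_eq_iff (by positivity)]
    linear_combination -(2 + u) * hr
  simp only [airyRemainder, airyCubic, Function.comp, hv', airyRoot, hs, ← he, ← hd]
  generalize (1 + u / 3) ^ (-(1 / 2) : ℝ) = r at *
  clear_value e d
  linear_combination (1 + u / 2) * ((lam - 1 / 3) * u + e * u ^ 2 * (1 + u / 3) * r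
    + d * u ^ 3 * (1 + u / 3) * ((1 + u / 3) * r ^ 2 + 1)) * hr + u ^ 2 * he' + u ^ 3 * hd

end Taylor

/-! ### The expansion at +∞ -/

section AtTop

theorem airyPhase_ge {y : ℝ} (hy : 0 < y) : 2 / 3 * (y - 1) ^ 2 ≤ airyPhase y := by
  rw [airyPhase]
  nlinarith [mul_nonneg (sq_nonneg (y - 1)) hy.le]

theorem airyPhase_eq (y : ℝ) : airyPhase y = 2 / 3 + (y ^ 3 / 3 - y) := by
  rw [airyPhase]
  ring

theorem measurable_airyPhase : Measurable airyPhase := by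
  unfold airyPhase
  fun_prop

theorem measurable_airyCubic (lam : ℝ) : Measurable (airyCubic lam) := by
  unfold airyCubic
  fun_prop

theorem measurable_airyRemainder (lam : ℝ) : Measurable (airyRemainder lam) := by
  unfold airyRemainder airyRootDeriv airyCubic airyRoot
  fun_prop

theorem integrableOn_rpow_mul_exp_airyPhase {lam : ℝ} (hlam : -1 < lam) {τ : ℝ} (hτ : 1 ≤ τ) :
    IntegrableOn (fun y : ℝ => y ^ lam * Real.exp (-(τ * airyPhase y))) (Set.Ioi 0) := by
  have h := (integrableOn_rpow_mul_exp_cubic hlam 1).const_mul (Real.exp (-(2 / 3)))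
  refine h.mono' ?_ ?_
  · have := measurable_airyPhase
    exact Measurable.aestronglyMeasurable (by fun_prop)
  · refine (ae_restrict_mem measurableSet_Ioi).mono fun y hy => ?_
    have hy : 0 < y := hy
    rw [Real.norm_of_nonneg (by positivity), mul_left_comm, ← Real.exp_add]
    refine mul_le_mul_of_nonneg_left (Real.exp_le_exp.2 ?_) (Real.rpow_nonneg hy.le _)
    have h1 : 0 ≤ airyPhase y := le_trans (by positivity) (airyPhase_ge hy)
    have h2 := airyPhase_eq y
    nlinarith

theorem integrable_airyCubic_mul_exp (lam : ℝ) {τ : ℝ} (hτ : 0 < τ) :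
    Integrable fun v : ℝ => airyCubic lam v * Real.exp (-(τ * v ^ 2)) := by
  have hi := integrable_pow_mul_exp_neg_mul_sq hτ
  refine ((((hi 0).add ((hi 1).const_mul (lam - 1 / 3))).add
    ((hi 2).const_mul (airyCoeff lam))).add ((hi 3).const_mul
      (lam * (lam - 1) * (lam - 2) / 6 - 1 / 108 - 2 * airyCoeff lam / 3))).congr
        (.of_forall fun v => ?_)
  simp only [airyCubic, Pi.add_apply]
  ring

theorem integrableOn_airyRootDeriv_mul (lam : ℝ) {τ : ℝ} (hτ : 0 < τ) :
    IntegrableOn (fun y => airyRootDeriv y * airyCubic lam (airyRoot y) *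
      Real.exp (-(τ * airyPhase y))) (Set.Ioi 0) := by
  refine (integrableOn_airyRoot (integrable_airyCubic_mul_exp lam hτ)).congr_fun
    (fun y hy => ?_) measurableSet_Ioi
  have hy : 0 < y := hy
  simp only [airyRoot_sq (show -2 < y by linarith)]
  ring

theorem laplaceBound_airyRemainder {lam : ℝ} (hlam : -1 < lam) :
    LaplaceBound (volume.restrict (Set.Ioi (0 : ℝ))) airyPhase (airyRemainder lam)
      (-(5 / 2)) := by
  obtain ⟨C, hC, hO⟩ := (isBigO_airyRemainder lam).exists_pos
  obtain ⟨δ, hδ, hball⟩ := Metric.eventually_nhds_iff.1 hO.bound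
  refine laplaceBound_of_le_pow_four measurableSet_Ioi (x₀ := 1) (κ := 2 / 3) (by norm_num) hδ
    hC.le measurable_airyPhase.aestronglyMeasurable ?_
    (measurable_airyRemainder lam).aestronglyMeasurable (fun y hy => airyPhase_ge hy)
    fun y _ hyδ => ?_
  · have h1 := integrableOn_rpow_mul_exp_airyPhase hlam le_rfl
    have h2 := integrableOn_airyRootDeriv_mul lam one_pos
    refine (h1.sub h2).congr (.of_forall fun y => ?_)
    simp only [airyRemainder, one_mul, Pi.sub_apply]
    ring
  · have := hball (y := y - 1) (by simpa [Real.dist_eq] using hyδ)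
    simpa using this

/-- The Gaussian tail added when the v-integral is extended to the whole line. It stays away from v
= 0, so the local hypothesis is vacuous with δ = -`airyRoot 0` and C = 0. -/
theorem laplaceBound_airyCubic (lam : ℝ) :
    LaplaceBound (volume.restrict (Set.Iic (airyRoot 0))) (fun v => v ^ 2) (airyCubic lam)
      (-(5 / 2)) := by
  have h0 : airyRoot 0 < 0 := by
    have : 0 < √((0 + 2 : ℝ) / 3) := by positivity
    rw [airyRoot]
    linarith
  refine laplaceBound_of_le_pow_four measurableSet_Iic (x₀ := 0) (κ := 1) (δ := -airyRoot 0)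
    (C := 0) one_pos (by linarith) le_rfl (by fun_prop) ?_
    (measurable_airyCubic lam).aestronglyMeasurable (fun y _ => by simp) fun v hv hvδ => ?_
  · simpa using (integrable_airyCubic_mul_exp lam one_pos).integrableOn
  · have hv : v ≤ airyRoot 0 := hv
    rw [sub_zero, abs_of_neg (by linarith)] at hvδ
    linarith

/-- The amplitude is split as `airyRootDeriv` times the cubic, plus a remainder. The first part
becomes a full Gaussian integral minus the tail, and its odd terms drop out. -/
theorem integral_rpow_mul_exp_airyPhase {lam : ℝ} (hlam : -1 < lam) {τ : ℝ} (hτ : 1 ≤ τ) :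
    ∫ y in Set.Ioi (0 : ℝ), y ^ lam * Real.exp (-(τ * airyPhase y))
      = √Real.pi * τ ^ (-(1 / 2) : ℝ) + airyCoeff lam * √Real.pi / 2 * τ ^ (-(1 / 2) - 1 : ℝ)
        + ((∫ y in Set.Ioi (0 : ℝ), airyRemainder lam y * Real.exp (-(τ * airyPhase y)))
          + -1 * ∫ v in Set.Iic (airyRoot 0), airyCubic lam v * Real.exp (-(τ * v ^ 2))) := by
  have hτ0 : 0 < τ := by linarith
  have hcub := integrable_airyCubic_mul_exp lam hτ0
  have h1 := integrableOn_rpow_mul_exp_airyPhase hlam hτ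
  have h2 := integrableOn_airyRootDeriv_mul lam hτ0
  have h3 : ∫ v : ℝ, airyCubic lam v * Real.exp (-(τ * v ^ 2)) = _ :=
    integral_cubic_mul_exp_neg_mul_sq hτ0 _ _ _
  have h4 := intervalIntegral.integral_Iic_add_Ioi (b := airyRoot 0) hcub.integrableOn
    hcub.integrableOn
  have h5 : ∫ v in Set.Ioi (airyRoot 0), airyCubic lam v * Real.exp (-(τ * v ^ 2))
      = ∫ y in Set.Ioi (0 : ℝ), airyRootDeriv y * airyCubic lam (airyRoot y) *
        Real.exp (-(τ * airyPhase y)) := by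
    rw [integral_airyRoot fun v => airyCubic lam v * Real.exp (-(τ * v ^ 2))]
    refine setIntegral_congr_fun measurableSet_Ioi fun y hy => ?_
    have hy : 0 < y := hy
    simp only [airyRoot_sq (show -2 < y by linarith)]
    ring
  have h6 : ∫ y in Set.Ioi (0 : ℝ), airyRemainder lam y * Real.exp (-(τ * airyPhase y))
      = (∫ y in Set.Ioi (0 : ℝ), y ^ lam * Real.exp (-(τ * airyPhase y)))
        - ∫ y in Set.Ioi (0 : ℝ), airyRootDeriv y * airyCubic lam (airyRoot y) *
          Real.exp (-(τ * airyPhase y)) := by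
    rw [← integral_sub h1 h2]
    simp only [airyRemainder, sub_mul]
  rw [← h3, ← h4, h5, h6]
  ring

theorem moment_zero_eq {lam t : ℝ} (ht : 0 < t) :
    moment lam 0 t = t ^ ((lam + 1) / 2) * (Real.exp (2 / 3 * t ^ (3 / 2 : ℝ)) *
      ∫ y in Set.Ioi (0 : ℝ), y ^ lam * Real.exp (-(t ^ (3 / 2 : ℝ) * airyPhase y))) := by
  set c : ℝ := √t with hc
  have hc0 : 0 < c := Real.sqrt_pos.2 ht
  have hct : c ^ 2 = t := Real.sq_sqrt ht.le
  have h3 : t ^ (3 / 2 : ℝ) = c ^ 3 := by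
    rw [hc, Real.sqrt_eq_rpow, ← Real.rpow_natCast, ← Real.rpow_mul ht.le]
    norm_num
  have h1 : t ^ ((lam + 1) / 2) = c * c ^ lam := by
    rw [hc, Real.sqrt_eq_rpow, ← Real.rpow_mul ht.le, ← Real.rpow_add ht]
    ring_nf
  have hsub := integral_comp_mul_left_Ioi (fun x : ℝ => x ^ 0 * weight lam t x) 0 hc0
  rw [mul_zero, smul_eq_mul, eq_inv_mul_iff_mul_eq₀ hc0.ne'] at hsub
  rw [moment, ← hsub, h1, h3, mul_assoc]
  congr 1
  rw [← integral_const_mul, ← integral_const_mul]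
  refine setIntegral_congr_fun measurableSet_Ioi fun y hy => ?_
  have hy : 0 < y := hy
  have hexp : Real.exp (-((c * y) ^ 3) / 3 + t * (c * y))
      = Real.exp (2 / 3 * c ^ 3) * Real.exp (-(c ^ 3 * airyPhase y)) := by
    rw [← Real.exp_add, airyPhase_eq, ← hct]
    ring_nf
  simp only [weight, pow_zero, one_mul]
  rw [hexp, Real.mul_rpow hc0.le hy.le]
  ring

theorem hasExpansion_log_moment_atTop {lam : ℝ} (hlam : -1 < lam) :
    HasExpansion (3 / 2) (3 / 2) (2 / 3) ((lam + 1) / 2 - 3 / 4) (Real.log (√Real.pi))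
      (airyCoeff lam / 2) fun t => Real.log (moment lam 0 t) := by
  have hpi : 0 < √Real.pi := Real.sqrt_pos.2 Real.pi_pos
  have hR1 := (laplaceBound_airyRemainder hlam).isSymbol
    measurable_airyPhase.aestronglyMeasurable
    ((ae_restrict_mem measurableSet_Ioi).mono fun y hy =>
      le_trans (by positivity) (airyPhase_ge hy))
  have hR2 := (laplaceBound_airyCubic lam).isSymbol (by fun_prop)
    (.of_forall fun v => sq_nonneg v)
  -- The expansion is made in τ and then composed with τ = t^{3/2}: order -2 becomes -3, and
  -- τ^{-1/2} contributes -3/4 to the coefficient of log t.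
  obtain ⟨R, hR, hlog⟩ := hasExpansion_log (q := 1) (e := 1 / 2) (p := 1) one_pos hpi
    (D := airyCoeff lam * √Real.pi / 2) ((hR1.add (hR2.const_mul (-1))).mono (by norm_num))
    (f := fun τ => ∫ y in Set.Ioi (0 : ℝ), y ^ lam * Real.exp (-(τ * airyPhase y)))
    ((eventually_ge_atTop 1).mono fun τ hτ => integral_rpow_mul_exp_airyPhase hlam hτ)
  refine ⟨fun t => R (t ^ (3 / 2 : ℝ)), (hR.comp_rpow (by norm_num)).mono (by norm_num), ?_⟩
  filter_upwards [(tendsto_rpow_atTop (show (0 : ℝ) < 3 / 2 by norm_num)).eventually hlog,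
    eventually_gt_atTop 0] with t h ht
  have hm : 0 < moment lam 0 t := by
    rw [← hankelDet_one]
    exact hankelDet_pos hlam 1 t
  have hint := moment_zero_eq (lam := lam) ht
  have hne : ∫ y in Set.Ioi (0 : ℝ), y ^ lam * Real.exp (-(t ^ (3 / 2 : ℝ) * airyPhase y)) ≠ 0 := by
    intro h0
    rw [h0, mul_zero, mul_zero] at hint
    exact hm.ne' hint
  rw [hint, Real.log_mul (Real.rpow_pos_of_pos ht _).ne' (mul_ne_zero (Real.exp_pos _).ne' hne),
    Real.log_mul (Real.exp_pos _).ne' hne, Real.log_exp, Real.log_rpow ht, h, Real.log_rpow ht,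
    Real.rpow_neg_one, ← Real.rpow_neg ht.le]
  field_simp
  ring

theorem hasExpansion_atTop {lam : ℝ} (hlam : -1 < lam) (n : ℕ) :
    HasExpansion (3 / 2) (3 / 2) (2 / 3 * (n : ℝ)) (-((n : ℝ) * ((n : ℝ) - 2 * lam) / 4))
      ((n : ℝ) / 2 * Real.log Real.pi - (n : ℝ) * ((n : ℝ) - 1) / 2 * Real.log 2
        + Real.log (barnesG ((n : ℝ) + 1)))
      ((n : ℝ) * (4 * (n : ℝ) ^ 2 - 24 * (n : ℝ) * lam + 12 * lam ^ 2 + 1) / 48)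
      fun t => Real.log (hankelDet lam n t) := by
  have hstep : ∀ z : ℝ, 0 < z →
      Real.log (barnesG (z + 1)) = Real.log (Real.Gamma z) + Real.log (barnesG z) := fun z hz => by
    rw [barnesG_add_one hz, Real.log_mul (Real.Gamma_pos_of_pos hz).ne' (barnesG_pos hz).ne']
  induction n using Nat.twoStepInduction with
  | zero =>
    convert! hasExpansion_zero (3 / 2) (3 / 2) (L := fun t => Real.log (hankelDet lam 0 t))
      fun t => by simp [hankelDet_zero] using 1
    · simp
    · simp
    · simp [barnesG_one]
    · simp
  | one =>
    have h2 : Real.log (barnesG 2) = 0 := by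
      have := hstep 1 one_pos
      rwa [Real.Gamma_one, barnesG_one, Real.log_one, add_zero, one_add_one_eq_two] at this
    convert! hasExpansion_log_moment_atTop hlam using 1
    · simp
    · push_cast
      ring
    · rw [Nat.cast_one, one_add_one_eq_two, h2, Real.log_sqrt Real.pi_pos.le]
      ring
    · rw [airyCoeff]
      push_cast
      ring
    · simp only [hankelDet_one]
  | more k h₀ h =>
    have hk : (0 : ℝ) ≤ k := Nat.cast_nonneg k
    obtain ⟨l, l', hl, hl', hN⟩ := log_hankelDet_toda hlam k
    obtain ⟨R, hR, hR'⟩ := h.second_deriv hl hl'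
    push_cast at h h₀ hR' ⊢
    -- The second derivative of a t^{-3/2} has order -7/2 = -(1/2) - 2 · (3/2), exactly that of the
    -- admissible remainder, so a does not enter the next step through the logarithm.
    have hRs := (((IsSymbol.rpow (-(3 / 2) - 2)).const_mul
      (((k : ℝ) + 1) * (4 * ((k : ℝ) + 1) ^ 2 - 24 * (k + 1) * lam + 12 * lam ^ 2 + 1) / 48 *
        (3 / 2) * (3 / 2 + 1))).mono (show (-(3 / 2) - 2 : ℝ) ≤ -(1 / 2) - 2 * (3 / 2) by
          norm_num)).add (hR.mono (by norm_num))
    -- K = A · (3/2) · (1/2) comes from the t^{3/2} term, and D = -B from the logarithm.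
    have hlog := hasExpansion_log (p := 3 / 2) (q := 3 / 2) (K := ((k : ℝ) + 1) / 2)
      (e := 1 / 2) (D := ((k : ℝ) + 1) * ((k : ℝ) + 1 - 2 * lam) / 4)
      (by norm_num) (by linarith) hRs ?_ (f := l')
    · have := h.toda_step h₀ hlog hN
      convert! this using 1
      · ring
      · ring
      · rw [show (k : ℝ) + 2 + 1 = k + 1 + 1 + 1 by ring, hstep _ (by linarith),
          hstep (k + 1) (by linarith), Real.Gamma_add_one (show (k : ℝ) + 1 ≠ 0 by linarith),
          Real.log_mul (by linarith) (Real.Gamma_pos_of_pos (by linarith)).ne',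
          Real.log_div (by linarith) two_ne_zero]
        ring
      · have h1 : (k : ℝ) + 1 ≠ 0 := by linarith
        field_simp
        ring
    · filter_upwards [hR'] with t ht
      rw [ht, show (3 / 2 : ℝ) - 2 = -(1 / 2) by norm_num,
        show (-(1 / 2) - 3 / 2 : ℝ) = -2 by norm_num]
      ring

end AtTop

/-! ### Return to O-terms in t -/

theorem HasExpansion.isBigO {p q A B C a : ℝ} {L : ℝ → ℝ} (h : HasExpansion p q A B C a L) :
    (fun t => L t - (A * t ^ p + B * Real.log t + C + a * t ^ (-q)))
      =O[atTop] fun t : ℝ => t ^ (-(2 * q)) := by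
  obtain ⟨R, hR, hL⟩ := h
  refine hR.isBigO.congr' ?_ EventuallyEq.rfl
  filter_upwards [hL] with t ht
  rw [ht]
  ring

end GeneralizedAiry

theorem theorem5p3 (lam : ℝ) (hlam : -1 < lam) (n : ℕ) :
    -- all the moments converge and the Hankel determinant is positive
    (∀ (j : ℕ) (t : ℝ), MeasureTheory.IntegrableOn
      (fun x : ℝ => x ^ j * GeneralizedAiry.weight lam t x) (Set.Ioi 0)) ∧
    (∀ t : ℝ, 0 < GeneralizedAiry.hankelDet lam n t) ∧
    -- the expansion as `t → +∞`
    ((fun t : ℝ => Real.log (GeneralizedAiry.hankelDet lam n t) -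
        (2 / 3 * (n : ℝ) * t ^ (3 / 2 : ℝ)
          - (n : ℝ) * ((n : ℝ) - 2 * lam) / 4 * Real.log t
          + ((n : ℝ) / 2 * Real.log Real.pi
              - (n : ℝ) * ((n : ℝ) - 1) / 2 * Real.log 2
              + Real.log (GeneralizedAiry.barnesG ((n : ℝ) + 1)))
          + (n : ℝ) * (4 * (n : ℝ) ^ 2 - 24 * (n : ℝ) * lam + 12 * lam ^ 2 + 1)
              / (48 * t ^ (3 / 2 : ℝ))))
      =O[atTop] fun t : ℝ => t ^ (-3 : ℤ)) ∧
    -- the expansion as `t → -∞`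
    ((fun t : ℝ => Real.log (GeneralizedAiry.hankelDet lam n t) -
        (-((n : ℝ) * ((n : ℝ) + lam)) * Real.log (-t)
          + Real.log (GeneralizedAiry.barnesG ((n : ℝ) + 1)
              * GeneralizedAiry.barnesG ((n : ℝ) + lam + 1)
              / GeneralizedAiry.barnesG (lam + 1))
          + (n : ℝ) * ((n : ℝ) + lam) *
              (5 * (n : ℝ) ^ 2 + 5 * (n : ℝ) * lam + lam ^ 2 + 1) / (3 * t ^ 3)))
      =O[atBot] fun t : ℝ => t ^ (-6 : ℤ)) := by
  refine ⟨fun j t => GeneralizedAiry.integrableOn_pow_mul_weight hlam j t,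
    fun t => GeneralizedAiry.hankelDet_pos hlam n t, ?_, ?_⟩
  · refine (GeneralizedAiry.hasExpansion_atTop hlam n).isBigO.congr' ?_ ?_
    · filter_upwards [eventually_gt_atTop 0] with t ht
      rw [Real.rpow_neg ht.le]
      ring
    · filter_upwards with t
      rw [← Real.rpow_intCast]
      norm_num
  · refine ((GeneralizedAiry.hasExpansion_atBot hlam n).isBigO.comp_tendsto
      tendsto_neg_atBot_atTop).congr' ?_ ?_
    · filter_upwards [eventually_lt_atBot 0] with t ht
      -- The oddness of the cube turns the negative coefficient in s = -t into the positive one in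
      -- t.
      have h3 : (-t) ^ (-3 : ℝ) = -(t ^ 3)⁻¹ := by
        have : (-t) ^ (-3 : ℝ) = (-t) ^ (-3 : ℤ) := by
          rw [← Real.rpow_intCast]
          norm_num
        rw [this, zpow_neg, ← inv_neg, ← Odd.neg_pow (by decide)]
        norm_cast
      simp only [Function.comp, neg_neg, h3]
      ring
    · filter_upwards with t
      have : (-t) ^ (-(2 * 3) : ℝ) = (-t) ^ (-6 : ℤ) := by
        rw [← Real.rpow_intCast]
        norm_num
      simp only [Function.comp, this]
      exact Even.neg_zpow (by decide) t
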